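/- Let $d\in\mathbb N$, $\hbar>0$, $k_B>0$, $H=L^2(\mathbb R^d,\mathbb C)$, and $s(x)=-k_B[x\ln x+(1-x)\ln(1-x)]$ for $x\in[0,1]$ (with $0\ln 0=0$). Let $\epsilon:\mathbb R^d\to\mathbb R$ be an energy band, differentiable almost everywhere with gradient $\mathbf v=\nabla_{\mathbf p}\epsilon$, let $\eta_0,\eta_1:\mathbb R^d\to\mathbb R$ and $\boldsymbol\eta_2:\mathbb R^d\to\mathbb R^d$ be smooth (the Lagrange multipliers), and put $$(\boldsymbol\eta\cdot\boldsymbol\psi)(\mathbf x,\mathbf p)=\eta_0(\mathbf x)+\eta_1(\mathbf x)\,\epsilon(\mathbf p)+\boldsymbol\eta_2(\mathbf x)\cdot\mathbf v(\mathbf p).$$ For a real symbol $a(\mathbf x,\mathbf p)$, $Op_\hbar(a)$ denotes a (possibly unbounded) self-adjoint operator on $H$ whose domain contains $C_c^\infty(\mathbb R^d,\mathbb C)$ and which acts there by Weyl's formula $$Op_\hbar(a)\varphi(\mathbf x)=\frac1{(2\pi\hbar)^d}\int\!\!\int a\Big(\frac{\mathbf x+\mathbf y}2,\mathbf p\Big)\varphi(\mathbf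 y)\,e^{i(\mathbf x-\mathbf y)\cdot\mathbf p/\hbar}\,d\mathbf y\,d\mathbf p ,$$ the iterated integrals being convergent. Assume that such operators $Op_\hbar(\epsilon)$, $Op_\hbar(v_i)$ ($1\le i\le d$) and $Op_\hbar(\boldsymbol\eta\cdot\boldsymbol\psi)$ are given (if the self-adjoint realization is not unique, any choice is allowed), and let $Op_\hbar(1)=\mathrm{Id}$. Say that the expectation value $\mathrm{tr}\{\rho A\}$ exists if the product of $\rho$ and $A$, in the form $A\rho$, is an everywhere defined trace class operator. Let $\mathcal M$ be the set of bounded positive operators on $H$ with finite trace (hence Hilbert-Schmidt) for which the expectation values of $Op_\hbar(\epsilon)$, of all $Op_\hbar(v_i)$ and of $Op_\hbar(\boldsymbol\eta\cdot\boldsymbol\psi)$ exist, and let $\mathcal D$ be the set of $\rho\in\mathcal M$ with $\rho\le1$ and finite entropy $S(\rho)=\mathrm{Tr}\,s(\rho)$. Given prescribed moments $\mathbf M=(n,W,\mathbf J)$, functions of $\mathbf x$ such that $\boldsymbol\eta\cdot\mathbf M$ is integrable on $\mathbb R^d$, consider on $\mathcal D$ the Lagrangian $$\mathcal L(\rho,\boldsymbol\eta)=S(\rho)-\mathrm{tr}\{\rho\,Op_\hbar(\boldsymbol\eta\cdot\boldsymbol\psi)\}+\int_{\mathbb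 R^d}\boldsymbol\eta\cdot\mathbf M\,d\mathbf x$$ of the problem of maximizing $S$ under prescribed expectation values of $Op_\hbar(1)$, $Op_\hbar(\epsilon)$, $Op_\hbar(\mathbf v)$. The first-order optimality condition for $\rho\in\mathcal D$ is that for every $\delta\rho\in\mathcal M$ with $\mathrm{tr}\,\delta\rho=1$, $\rho+t\,\delta\rho\in\mathcal D$ for all small $t>0$ and $\lim_{t\downarrow0}t^{-1}\big(\mathcal L(\rho+t\,\delta\rho,\boldsymbol\eta)-\mathcal L(\rho,\boldsymbol\eta)\big)=0$. Then $s'$ is a bijection from $(0,1)$ onto $\mathbb R$ with inverse $(s')^{-1}(z)=\dfrac1{e^{z/k_B}+1}$. For every $\rho\in\mathcal D$ (in particular, for every such $\rho$ of trace one), the following conditions are equivalent: 1. $\rho$ satisfies the first-order optimality condition; 2. $\rho=(s')^{-1}\big(Op_\hbar(\boldsymbol\eta\cdot\boldsymbol\psi)\big)$ in the sense of the functional calculus; 3. $\rho=\big(\exp(Op_\hbar(\boldsymbol\eta\cdot\boldsymbol\psi)/k_B)+1\big)^{-1}$. If they hold, $\rho$ is a maximum point of $\mathcal L(\cdot,\boldsymbol\eta)$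 on $\mathcal D$. -/

import Mathlib

open MeasureTheory Filter Topology
open scoped InnerProductSpace ContDiff

noncomputable section

namespace QMEP

section HilbertSpace

/-! The operator theoretic notions, for a complex Hilbert space `H`. -/

variable {H : Type} [NormedAddCommGroup H] [InnerProductSpace ℂ H] [CompleteSpace H]

/-- A bounded operator regarded as an everywhere defined operator. -/
def toUnbOp (ρ : H →L[ℂ] H) : H →ₗ.[ℂ] H :=
  (ρ : H →ₗ[ℂ] H).toPMap ⊤

/-! ### Functional calculus of an unbounded self-adjoint operator -/

/-- `A` corresponds, under the unitary map `U : H → L²(X, μ)`, to the multiplication by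
the real function `h` on its maximal domain. -/
def IsMultiplicationBy {X : Type} [MeasurableSpace X] {μ : Measure X}
    (U : H ≃ₗᵢ[ℂ] Lp ℂ 2 μ) (h : X → ℝ) (A : H →ₗ.[ℂ] H) : Prop :=
  (∀ u : H, u ∈ A.domain ↔ MemLp (fun x => (h x : ℂ) * (U u : X → ℂ) x) 2 μ) ∧
  ∀ u : A.domain,
    (U (A u) : X → ℂ) =ᵐ[μ] fun x => (h x : ℂ) * (U (u : H) : X → ℂ) x

/-- `B = f(A)` for a self-adjoint operator `A` and a Borel function `f`: the functional calculus
in multiplication operator form, `A = U⁻¹ M_h U` and `f(A) = U⁻¹ M_{f ∘ h} U`. -/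
def IsFunctionOf (A : H →ₗ.[ℂ] H) (f : ℝ → ℝ) (B : H →ₗ.[ℂ] H) : Prop :=
  ∃ (X : Type) (_ : MeasurableSpace X) (μ : Measure X) (U : H ≃ₗᵢ[ℂ] Lp ℂ 2 μ) (h : X → ℝ),
    Measurable h ∧ IsMultiplicationBy U h A ∧ IsMultiplicationBy U (fun x => f (h x)) B

/-- The bounded operator `ρ` is the inverse `(B + 1)⁻¹` of the operator `B + 1`. -/
def IsInverseOfAddOne (B : H →ₗ.[ℂ] H) (ρ : H →L[ℂ] H) : Prop :=
  (∀ u : H, ∃ h : ρ u ∈ B.domain, B ⟨ρ u, h⟩ + ρ u = u) ∧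
  ∀ u : B.domain, ρ (B u + (u : H)) = u

/-! ### Traces -/

/-- `T` is of trace class with trace `z`: the sum of the diagonal elements converges to `z` in
every Hilbert basis. -/
def HasTrace (T : H →L[ℂ] H) (z : ℂ) : Prop :=
  ∀ (ι : Type) (b : HilbertBasis ι ℂ H), HasSum (fun i => ⟪b i, T (b i)⟫_ℂ) z

/-- `T` is of trace class. -/
def IsTraceClass (T : H →L[ℂ] H) : Prop := ∃ z, HasTrace T z

open Classical in
/-- The trace of a trace class operator (`0` otherwise). -/
def trace (T : H →L[ℂ] H) : ℂ := if h : IsTraceClass T then h.choose else 0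

/-- The trace does not depend on the basis. -/
theorem HasTrace.trace_eq {T : H →L[ℂ] H} {z : ℂ} (h : HasTrace T z) : trace T = z := by
  have hT : IsTraceClass T := ⟨z, h⟩
  obtain ⟨w, b, -⟩ := exists_hilbertBasis ℂ H
  rw [trace, dif_pos hT]
  exact (hT.choose_spec w b).unique (h w b)

/-- The bounded operator `T` is the product `A ρ`, which is everywhere defined. -/
def IsProduct (A : H →ₗ.[ℂ] H) (ρ : H →L[ℂ] H) (T : H →L[ℂ] H) : Prop :=
  ∀ u : H, ∃ h : ρ u ∈ A.domain, T u = A ⟨ρ u, h⟩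

/-- The expectation value `tr{ρ A}` exists: `A ρ` is everywhere defined and of trace class.
(For self-adjoint `A` and `ρ`, the bounded operator `A ρ` is the adjoint of the closure
of `ρ A`.) -/
def HasExpectation (A : H →ₗ.[ℂ] H) (ρ : H →L[ℂ] H) : Prop :=
  ∃ T : H →L[ℂ] H, IsProduct A ρ T ∧ IsTraceClass T

open Classical in
/-- The expectation value `tr{ρ A}` (`0` if it does not exist). -/
def expectation (A : H →ₗ.[ℂ] H) (ρ : H →L[ℂ] H) : ℂ :=
  if h : HasExpectation A ρ then trace h.choose else 0

/-! ### Entropy, Lagrangian, optimality condition -/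

/-- The function `s(x) = -k_B [x ln x + (1-x) ln (1-x)]`. -/
def s (kB : ℝ) (x : ℝ) : ℝ :=
  -kB * (x * Real.log x + (1 - x) * Real.log (1 - x))

/-- The inverse function `(s')⁻¹` of the derivative of `s` on `(0,1)`. -/
def sDerivInv (kB : ℝ) : ℝ → ℝ :=
  Function.invFunOn (deriv (s kB)) (Set.Ioo 0 1)

/-- The entropy `S(ρ) = Tr s(ρ)`, with `s(ρ)` given by the continuous functional calculus. -/
def entropy (kB : ℝ) (ρ : H →L[ℂ] H) : ℝ := (trace (cfc (s kB) ρ)).re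

variable {d : ℕ}

/-- Positive operators of finite trace (hence Hilbert-Schmidt) for which the expectation values of
`Op_ħ(1) = Id`, `Oε = Op_ħ(ε)`, `Ov i = Op_ħ(v_i)` and `A = Op_ħ(η · ψ)` exist. -/
def HasMoments (Oε : H →ₗ.[ℂ] H) (Ov : Fin d → (H →ₗ.[ℂ] H)) (A : H →ₗ.[ℂ] H)
    (ρ : H →L[ℂ] H) : Prop :=
  ρ.IsPositive ∧ IsTraceClass ρ ∧ HasExpectation Oε ρ ∧ (∀ i, HasExpectation (Ov i) ρ) ∧
    HasExpectation A ρ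

/-- The operators on which the Lagrangian is defined: `0 ≤ ρ ≤ 1`, the trace and the expectation
values exist, and the entropy is finite. The trace is not normalized here. -/
def lagrangianDomain (kB : ℝ) (Oε : H →ₗ.[ℂ] H) (Ov : Fin d → (H →ₗ.[ℂ] H)) (A : H →ₗ.[ℂ] H) :
    Set (H →L[ℂ] H) :=
  {ρ | HasMoments Oε Ov A ρ ∧ (1 - ρ).IsPositive ∧ IsTraceClass (cfc (s kB) ρ)}

/-- The perturbations `δρ`: positive, with trace one, and such that the expectation values
exist. -/
def perturbations (Oε : H →ₗ.[ℂ] H) (Ov : Fin d → (H →ₗ.[ℂ] H)) (A : H →ₗ.[ℂ] H) :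
    Set (H →L[ℂ] H) :=
  {δ | HasMoments Oε Ov A δ ∧ trace δ = 1}

/-- The first order optimality condition for `F` on the set `D`: along every direction `δ ∈ V`
the functional `F` is Gâteaux differentiable at `ρ`, with derivative zero. The directions being
positive operators, the derivative is the limit of `(F(ρ + t δ) - F(ρ)) / t` for `t ↓ 0`, which
requires that `ρ + t δ` lies in `D` for small `t > 0`. -/
def IsFirstOrderOptimal (F : (H →L[ℂ] H) → ℝ) (D V : Set (H →L[ℂ] H)) (ρ : H →L[ℂ] H) : Prop :=
  ∀ δ ∈ V, (∀ᶠ t : ℝ in 𝓝[>] 0, ρ + (t : ℂ) • δ ∈ D) ∧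
    HasDerivWithinAt (fun t : ℝ => F (ρ + (t : ℂ) • δ)) 0 (Set.Ici 0) 0

end HilbertSpace

section PhaseSpace

/-- The configuration space `ℝ^d` (also the space of momenta). -/
abbrev E (d : ℕ) : Type := EuclideanSpace ℝ (Fin d)

/-- The Hilbert space `L²(ℝ^d, ℂ)`. -/
abbrev L2 (d : ℕ) : Type := Lp ℂ 2 (volume : Measure (E d))

variable {d : ℕ}

/-! ### Weyl quantization -/

/-- The integrand `a((x+y)/2, p) φ(y) exp(i (x-y)·p/ħ)` of Weyl's formula. -/
def weylIntegrand (ħ : ℝ) (a : E d → E d → ℝ) (φ : E d → ℂ) (x p y : E d) : ℂ :=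
  (a ((1 / 2 : ℝ) • (x + y)) p : ℂ) * φ y *
    Complex.exp (Complex.I * ((⟪x - y, p⟫_ℝ / ħ : ℝ) : ℂ))

/-- `A` is the operator `Op_ħ(a)`: a self-adjoint operator on `L²(ℝ^d, ℂ)` whose domain contains
the test functions `φ ∈ C_c^∞(ℝ^d, ℂ)`, on which it acts by Weyl's formula
`(A φ)(x) = (2πħ)^{-d} ∫∫ a((x+y)/2, p) φ(y) exp(i (x-y)·p/ħ) dy dp`
for almost every `x`, all the integrals being convergent.
(If this determines `A` only up to the choice of a self-adjoint extension, every choice is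
allowed.) -/
def IsWeylQuantization (ħ : ℝ) (a : E d → E d → ℝ) (A : L2 d →ₗ.[ℂ] L2 d) : Prop :=
  IsSelfAdjoint A ∧
  ∀ φ : E d → ℂ, ContDiff ℝ ∞ φ → HasCompactSupport φ →
    ∀ u : L2 d, (u : E d → ℂ) =ᵐ[volume] φ →
      ∃ hu : u ∈ A.domain, ∀ᵐ x : E d,
        (∀ᵐ p : E d, Integrable (fun y : E d => weylIntegrand ħ a φ x p y)) ∧
        Integrable (fun p : E d => ∫ y : E d, weylIntegrand ħ a φ x p y) ∧
        (A ⟨u, hu⟩ : E d → ℂ) x =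
          (((2 * Real.pi * ħ) ^ d : ℝ) : ℂ)⁻¹ *
            ∫ p : E d, ∫ y : E d, weylIntegrand ħ a φ x p y

/-- The symbol `η · ψ = η₀(x) + η₁(x) ε(p) + η₂(x) · v(p)`. -/
def multiplierSymbol (η₀ η₁ : E d → ℝ) (η₂ : E d → E d) (ε : E d → ℝ) (v : E d → E d)
    (x p : E d) : ℝ :=
  η₀ x + η₁ x * ε p + ⟪η₂ x, v p⟫_ℝ

/-! ### Lagrangian -/

/-- The Lagrangian `S(ρ) - tr{ρ Op_ħ(η · ψ)} + ∫ η · M dx`, where `A = Op_ħ(η · ψ)` and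
`M = (n, W, J)` are the prescribed moments. -/
def lagrangian (kB : ℝ) (A : L2 d →ₗ.[ℂ] L2 d) (η₀ η₁ : E d → ℝ) (η₂ : E d → E d)
    (n W : E d → ℝ) (J : E d → E d) (ρ : L2 d →L[ℂ] L2 d) : ℝ :=
  entropy kB ρ - (expectation A ρ).re + ∫ x, (η₀ x * n x + η₁ x * W x + ⟪η₂ x, J x⟫_ℝ)

end PhaseSpace

end QMEP

end

noncomputable section

namespace QMEP

set_option linter.unusedSectionVars false

section Traces

variable {H : Type} [NormedAddCommGroup H] [InnerProductSpace ℂ H] [CompleteSpace H]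

/-- The quadratic form `Re ⟨x, T x⟩`. -/
def quad (T : H →L[ℂ] H) (x : H) : ℝ := (⟪x, T x⟫_ℂ).re

theorem quad_add (S T : H →L[ℂ] H) (x : H) : quad (S + T) x = quad S x + quad T x := by
  simp [quad]

theorem quad_sub (S T : H →L[ℂ] H) (x : H) : quad (S - T) x = quad S x - quad T x := by
  simp [quad]

theorem quad_smul (t : ℝ) (T : H →L[ℂ] H) (x : H) : quad ((t : ℂ) • T) x = t * quad T x := by
  simp [quad]

theorem quad_one (x : H) : quad 1 x = ‖x‖ ^ 2 := by
  have := inner_self_eq_norm_sq (𝕜 := ℂ) x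
  simpa [quad] using this

theorem quad_eigenvector {T : H →L[ℂ] H} {x : H} {l : ℝ} (h : T x = (l : ℂ) • x) :
    quad T x = l * ‖x‖ ^ 2 := by
  rw [← quad_one, quad, quad, h, inner_smul_right, Complex.re_ofReal_mul]
  rfl

theorem abs_quad_le (T : H →L[ℂ] H) (x : H) : |quad T x| ≤ ‖T‖ * ‖x‖ ^ 2 := by
  calc |quad T x| ≤ ‖⟪x, T x⟫_ℂ‖ := Complex.abs_re_le_norm _
    _ ≤ ‖x‖ * ‖T x‖ := norm_inner_le_norm _ _
    _ ≤ ‖x‖ * (‖T‖ * ‖x‖) := by gcongr; exact T.le_opNorm x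
    _ = _ := by ring

theorem quad_mono {S T : H →L[ℂ] H} (h : S ≤ T) (x : H) : quad S x ≤ quad T x := by
  have := ((ContinuousLinearMap.le_def _ _).1 h).re_inner_nonneg_right x
  have h2 : (0 : ℝ) ≤ quad (T - S) x := this
  rw [quad_sub] at h2
  linarith

theorem quad_nonneg {T : H →L[ℂ] H} (h : T.IsPositive) (x : H) : 0 ≤ quad T x :=
  h.re_inner_nonneg_right x

theorem le_of_quad_le {S T : H →L[ℂ] H} (hS : IsSelfAdjoint S) (hT : IsSelfAdjoint T)
    (h : ∀ x, quad S x ≤ quad T x) : S ≤ T := by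
  rw [ContinuousLinearMap.le_def, ContinuousLinearMap.isPositive_def']
  refine ⟨hT.sub hS, fun x => ?_⟩
  have := h x
  rw [ContinuousLinearMap.reApplyInnerSelf_apply, inner_re_symm]
  have h2 : quad (T - S) x = quad T x - quad S x := quad_sub _ _ _
  have h3 : quad (T - S) x = RCLike.re ⟪x, (T - S) x⟫_ℂ := rfl
  linarith

theorem inner_eq_quad {T : H →L[ℂ] H} (h : IsSelfAdjoint T) (x : H) :
    ⟪x, T x⟫_ℂ = (quad T x : ℂ) := by
  have hs := (ContinuousLinearMap.isSelfAdjoint_iff_isSymmetric.1 h)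
  have h1 : (starRingEnd ℂ) ⟪x, T x⟫_ℂ = ⟪x, T x⟫_ℂ := by
    rw [inner_conj_symm]; exact hs x x
  exact (Complex.conj_eq_iff_re.1 h1).symm

theorem inner_apply_left {T : H →L[ℂ] H} (h : IsSelfAdjoint T) (x y : H) :
    ⟪T x, y⟫_ℂ = ⟪x, T y⟫_ℂ :=
  ContinuousLinearMap.isSelfAdjoint_iff_isSymmetric.1 h x y

theorem exists_sqrt {T : H →L[ℂ] H} (h : T.IsPositive) :
    ∃ R : H →L[ℂ] H, IsSelfAdjoint R ∧ R * R = T := by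
  have h0 : 0 ≤ T := (ContinuousLinearMap.nonneg_iff_isPositive T).2 h
  exact ⟨CFC.sqrt T, IsSelfAdjoint.of_nonneg (CFC.sqrt_nonneg T), CFC.sqrt_mul_sqrt_self T h0⟩

theorem quad_mul_self {R : H →L[ℂ] H} (h : IsSelfAdjoint R) (x : H) :
    quad (R * R) x = ‖R x‖ ^ 2 := by
  rw [quad, mul_apply_eq_comp, ← inner_apply_left h]
  have := inner_self_eq_norm_sq (𝕜 := ℂ) (R x)
  simpa using this

theorem hasSum_eigenvalue_mul_norm_inner_sq {ι : Type} {b : HilbertBasis ι ℂ H} {G : H →L[ℂ] H}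
    (hG : IsSelfAdjoint G) {l : ι → ℝ} (hb : ∀ i, G (b i) = (l i : ℂ) • b i) (x : H) :
    HasSum (fun i => l i * ‖⟪b i, x⟫_ℂ‖ ^ 2) (quad G x) := by
  have h := Complex.hasSum_re (b.hasSum_inner_mul_inner x (G x))
  refine h.congr_fun fun i => ?_
  rw [← inner_apply_left hG, hb, inner_smul_left, ← inner_conj_symm x (b i)]
  simp only [Complex.conj_ofReal]
  rw [mul_left_comm, ← Complex.normSq_eq_conj_mul_self, Complex.normSq_eq_norm_sq]
  norm_cast

theorem hasSum_norm_inner_sq {ι : Type} (b : HilbertBasis ι ℂ H) (x : H) :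
    HasSum (fun i => ‖⟪b i, x⟫_ℂ‖ ^ 2) (‖x‖ ^ 2) := by
  have h := hasSum_eigenvalue_mul_norm_inner_sq (b := b) (G := 1) (l := fun _ => 1)
    (IsSelfAdjoint.one _) (by simp) x
  simpa only [one_mul, quad_one] using h

/-- For a positive operator `R²` of finite trace and a bounded self-adjoint operator `G`,
the trace of `R G R` can be computed in an eigenbasis of `G`. -/
theorem hasSum_eigenvalue_mul_quad {ι κ : Type} (b : HilbertBasis ι ℂ H) {f : HilbertBasis κ ℂ H}
    {R G : H →L[ℂ] H} (hR : IsSelfAdjoint R) (hG : IsSelfAdjoint G) {l : κ → ℝ}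
    (hf : ∀ j, G (f j) = (l j : ℂ) • f j) (hs : Summable fun i => quad (R * R) (b i)) :
    HasSum (fun j => l j * quad (R * R) (f j)) (∑' i, quad G (R (b i))) := by
  have hl : ∀ j, |l j| ≤ ‖G‖ := fun j => by
    have := abs_quad_le G (f j)
    rw [quad_eigenvector (hf j), f.orthonormal.1 j] at this
    simpa using this
  have h1 : ∀ i, HasSum (fun j => ‖⟪f j, R (b i)⟫_ℂ‖ ^ 2) (quad (R * R) (b i)) := fun i => by
    rw [quad_mul_self hR]; exact hasSum_norm_inner_sq f _
  have h2 : ∀ j, HasSum (fun i => ‖⟪f j, R (b i)⟫_ℂ‖ ^ 2) (quad (R * R) (f j)) := fun j => by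
    rw [quad_mul_self hR]
    convert hasSum_norm_inner_sq b (R (f j)) using 3 with i
    rw [← inner_apply_left hR, norm_inner_symm]
  have hsum : Summable fun p : ι × κ => ‖⟪f p.2, R (b p.1)⟫_ℂ‖ ^ 2 := by
    rw [summable_prod_of_nonneg (fun p => by positivity)]
    exact ⟨fun i => (h1 i).summable, by simpa only [fun i => (h1 i).tsum_eq] using hs⟩
  have hsum2 : Summable fun p : ι × κ => l p.2 * ‖⟪f p.2, R (b p.1)⟫_ℂ‖ ^ 2 := by
    refine Summable.of_norm_bounded (hsum.mul_left ‖G‖) fun p => ?_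
    rw [norm_mul, Real.norm_eq_abs, Real.norm_eq_abs, abs_of_nonneg (by positivity : (0:ℝ) ≤ ‖⟪f p.2, R (b p.1)⟫_ℂ‖ ^ 2)]
    gcongr
    exact hl _
  have h3 := hsum2.hasSum.prod_fiberwise
    (fun i => hasSum_eigenvalue_mul_norm_inner_sq hG hf (R (b i)))
  have h4 : HasSum (fun p : κ × ι => l p.1 * ‖⟪f p.1, R (b p.2)⟫_ℂ‖ ^ 2)
      (∑' p : ι × κ, l p.2 * ‖⟪f p.2, R (b p.1)⟫_ℂ‖ ^ 2) :=
    (Equiv.prodComm κ ι).hasSum_iff.2 hsum2.hasSum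
  rw [h3.tsum_eq]
  exact h4.prod_fiberwise fun j => (h2 j).mul_left (l j)

theorem IsTraceClass.hasSum_quad {ι : Type} {T : H →L[ℂ] H} (h : IsTraceClass T)
    (b : HilbertBasis ι ℂ H) : HasSum (fun i => quad T (b i)) (trace T).re := by
  obtain ⟨z, hz⟩ := h
  rw [hz.trace_eq]
  exact Complex.hasSum_re (hz ι b)

theorem hasTrace_of_isPositive {ι : Type} {T : H →L[ℂ] H} (hT : T.IsPositive)
    (b : HilbertBasis ι ℂ H) (hs : Summable fun i => quad T (b i)) :
    HasTrace T ((∑' i, quad T (b i) : ℝ) : ℂ) := by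
  intro κ f
  obtain ⟨R, hR, rfl⟩ := exists_sqrt hT
  have h := hasSum_eigenvalue_mul_quad b (f := f) (G := 1) (l := fun _ => 1) hR
    (IsSelfAdjoint.one _) (by simp) hs
  simp only [one_mul, quad_one, ← quad_mul_self hR] at h
  have h2 := Complex.hasSum_ofReal.2 h
  exact h2.congr_fun fun j => inner_eq_quad hT.isSelfAdjoint _

theorem IsTraceClass.add {S T : H →L[ℂ] H} (hS : IsTraceClass S) (hT : IsTraceClass T) :
    IsTraceClass (S + T) ∧ trace (S + T) = trace S + trace T := by
  obtain ⟨z, hz⟩ := hS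
  obtain ⟨w, hw⟩ := hT
  have h : HasTrace (S + T) (z + w) := fun ι b => by
    simpa [inner_add_right] using (hz ι b).add (hw ι b)
  exact ⟨⟨_, h⟩, by rw [h.trace_eq, hz.trace_eq, hw.trace_eq]⟩

theorem IsTraceClass.smul {T : H →L[ℂ] H} (hT : IsTraceClass T) (c : ℂ) :
    IsTraceClass (c • T) ∧ trace (c • T) = c * trace T := by
  obtain ⟨w, hw⟩ := hT
  have h : HasTrace (c • T) (c * w) := fun ι b => by
    simpa [inner_smul_right] using (hw ι b).mul_left c
  exact ⟨⟨_, h⟩, by rw [h.trace_eq, hw.trace_eq]⟩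

theorem opNorm_le_sqrt_of_hasSum {ι : Type} (b : HilbertBasis ι ℂ H) {T : H →L[ℂ] H} {a : ℝ}
    (h : HasSum (fun i => ‖T (b i)‖ ^ 2) a) : ‖T‖ ≤ √a := by
  rw [← LinearIsometryEquiv.norm_map ContinuousLinearMap.adjoint T]
  refine ContinuousLinearMap.opNorm_le_bound _ (Real.sqrt_nonneg _) fun y => ?_
  refine (sq_le_sq₀ (norm_nonneg _) (by positivity)).1 ?_
  rw [mul_pow, Real.sq_sqrt (h.nonneg fun _ => by positivity)]
  refine hasSum_le (fun i => ?_) (hasSum_norm_inner_sq b _) (h.mul_right (‖y‖ ^ 2))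
  rw [ContinuousLinearMap.adjoint_inner_right, ← mul_pow]
  gcongr
  exact norm_inner_le_norm _ _

theorem isCompactOperator_rankOne (x y : H) :
    IsCompactOperator (InnerProductSpace.rankOne ℂ x y) := by
  have h : IsCompactOperator (ContinuousLinearMap.toSpanSingleton ℂ x) :=
    isCompactOperator_of_locallyCompactSpace_rng _
  exact h.comp_clm (innerSL ℂ y)

theorem isCompactOperator_of_isTraceClass {T : H →L[ℂ] H} (hT : T.IsPositive)
    (h : IsTraceClass T) : IsCompactOperator T := by
  classical
  obtain ⟨w, b, -⟩ := exists_hilbertBasis ℂ H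
  have hs := (h.hasSum_quad b).summable
  obtain ⟨R, hR, rfl⟩ := exists_sqrt hT
  simp only [quad_mul_self hR] at hs
  let F : Finset w → H →L[ℂ] H := fun s => ∑ i ∈ s, InnerProductSpace.rankOne ℂ (R (b i)) (b i)
  have hF : ∀ s, IsCompactOperator (F s) := fun s =>
    Submodule.sum_mem (compactOperator (RingHom.id ℂ) H H)
      fun i _ => isCompactOperator_rankOne (R (b i)) (b i)
  have hFb : ∀ s i, (R - F s) (b i) = if i ∈ s then 0 else R (b i) := fun s i => by
    simp only [F, _root_.sub_apply, _root_.sum_apply,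
      InnerProductSpace.rankOne_apply, orthonormal_iff_ite.1 b.orthonormal, ite_smul, one_smul,
      zero_smul, Finset.sum_ite_eq']
    split_ifs <;> simp
  have hb : ∀ s, ‖R - F s‖ ≤ √(∑' i : w, ‖R (b i)‖ ^ 2 - ∑ i ∈ s, ‖R (b i)‖ ^ 2) := fun s => by
    refine opNorm_le_sqrt_of_hasSum b ?_
    have h1 : HasSum (fun i => if i ∈ s then ‖R (b i)‖ ^ 2 else 0) (∑ i ∈ s, ‖R (b i)‖ ^ 2) := by
      convert hasSum_sum_of_ne_finset_zero (f := fun i => if i ∈ s then ‖R (b i)‖ ^ 2 else 0)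
        (s := s) (fun i hi => by simp [hi]) using 1
      · exact Finset.sum_congr rfl fun i hi => by simp [hi]
      · infer_instance
    refine (hs.hasSum.sub h1).congr_fun fun i => ?_
    rw [hFb]
    split_ifs <;> simp
  have hlim : Tendsto F atTop (𝓝 R) := by
    rw [tendsto_iff_norm_sub_tendsto_zero]
    simp_rw [norm_sub_rev _ R]
    refine squeeze_zero (fun _ => norm_nonneg _) hb ?_
    have h1 : Tendsto (fun s : Finset w => ∑ i ∈ s, ‖R (b i)‖ ^ 2) atTop
      (𝓝 (∑' i, ‖R (b i)‖ ^ 2)) := hs.hasSum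
    have h2 := (Real.continuous_sqrt.tendsto _).comp
      ((tendsto_const_nhds (x := ∑' i, ‖R (b i)‖ ^ 2)).sub h1)
    simpa [Function.comp_def] using h2
  have hRc : IsCompactOperator R := isCompactOperator_of_tendsto hlim (.of_forall hF)
  exact hRc.comp_clm R

theorem exists_eigenbasis {T : H →L[ℂ] H} (hT : T.IsPositive) (h : IsTraceClass T) :
    ∃ (ι : Type) (b : HilbertBasis ι ℂ H) (l : ι → ℝ), ∀ i, T (b i) = (l i : ℂ) • b i := by
  have hc := isCompactOperator_of_isTraceClass hT h
  have hsym : (T : H →ₗ[ℂ] H).IsSymmetric := hT.isSymmetric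
  have hbot := ContinuousLinearMap.orthogonalComplement_iSup_eigenspaces_eq_bot hc hsym
  have hcl : ∀ μ : ℂ, IsClosed (Module.End.eigenspace (T : H →ₗ[ℂ] H) μ : Set H) := fun μ => by
    have : (Module.End.eigenspace (T : H →ₗ[ℂ] H) μ : Set H) = {x | T x = μ • x} := by
      ext x; simp
    rw [this]
    exact isClosed_eq T.continuous (continuous_const_smul μ)
  have : ∀ μ : ℂ, CompleteSpace (Module.End.eigenspace (T : H →ₗ[ℂ] H) μ) :=
    fun μ => (hcl μ).completeSpace_coe
  choose w e he using fun μ : ℂ => exists_hilbertBasis ℂ (Module.End.eigenspace (T : H →ₗ[ℂ] H) μ)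
  have hon := hsym.orthogonalFamily_eigenspaces.orthonormal_sigma_orthonormal
    (fun μ => (e μ).orthonormal)
  set v : (Σ μ : ℂ, w μ) → H := fun a => ((e a.1 a.2 : Module.End.eigenspace (T : H →ₗ[ℂ] H) a.1) : H)
    with hv
  have hon' : Orthonormal ℂ v := hon
  have hTv : ∀ a, T (v a) = a.1 • v a := fun a =>
    Module.End.mem_eigenspace_iff.1 (e a.1 a.2).2
  have hsp : (Submodule.span ℂ (Set.range v))ᗮ = ⊥ := by
    rw [eq_bot_iff, ← hbot]
    intro x hx
    rw [Submodule.mem_orthogonal'] at hx ⊢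
    intro y hy
    have hle : (⨆ μ, Module.End.eigenspace (T : H →ₗ[ℂ] H) μ) ≤ LinearMap.ker (innerₛₗ ℂ x) := by
      refine iSup_le fun μ z hz => ?_
      have h1 := (e μ).hasSum_repr ⟨z, hz⟩
      have h2 := h1.mapL ((innerSL ℂ x).comp (Module.End.eigenspace (T : H →ₗ[ℂ] H) μ).subtypeL)
      have h3 : ∀ i, ((innerSL ℂ x).comp (Module.End.eigenspace (T : H →ₗ[ℂ] H) μ).subtypeL)
          ((e μ).repr ⟨z, hz⟩ i • e μ i) = 0 := fun i => by
        have := hx (v ⟨μ, i⟩) (Submodule.subset_span ⟨_, rfl⟩)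
        simp only [hv] at this
        simp [this]
      simp only [h3] at h2
      exact (h2.unique hasSum_zero)
    exact hle hy
  refine ⟨_, HilbertBasis.mkOfOrthogonalEqBot hon' hsp, fun a => quad T (v a), fun a => ?_⟩
  rw [HilbertBasis.coe_mkOfOrthogonalEqBot, ← inner_eq_quad hT.isSelfAdjoint, hTv, inner_smul_right,
    inner_self_eq_norm_sq_to_K, hon'.1 a]
  simp

theorem cfc_apply_eigenvector {T : H →L[ℂ] H} (hT : IsSelfAdjoint T) {x : H} {l : ℝ}
    (hx : T x = (l : ℂ) • x) {f : ℝ → ℝ} (hf : ContinuousOn f (spectrum ℝ T)) :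
    cfc f T x = (f l : ℂ) • x := by
  by_cases hx0 : x = 0
  · simp [hx0]
  have hl : l ∈ spectrum ℝ T := by
    rw [spectrum.mem_iff]
    intro hu
    obtain ⟨S, hS⟩ := hu.exists_left_inv
    have h1 : (algebraMap ℝ (H →L[ℂ] H) l - T) x = 0 := by
      rw [_root_.sub_apply, hx, Algebra.algebraMap_eq_smul_one]
      simp
    have h2 := congrArg (fun S : H →L[ℂ] H => S x) hS
    simp only [mul_apply_eq_comp, h1, map_zero, one_apply_eq_self] at h2
    exact hx0 h2.symm
  rw [cfc_apply f T hT hf]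
  suffices h : ∀ g : C(spectrum ℝ T, ℝ), cfcHom hT g x = (g ⟨l, hl⟩ : ℂ) • x from h _
  intro g
  induction g using ContinuousMap.induction_on_of_compact with
  | const r =>
    have : ContinuousMap.const (spectrum ℝ T) r = algebraMap ℝ C(spectrum ℝ T, ℝ) r := rfl
    rw [this, AlgHomClass.commutes, Algebra.algebraMap_eq_smul_one]
    simp
  | id => rw [cfcHom_id hT]; simpa using hx
  | star_id => rw [map_star, cfcHom_id hT, hT.star_eq]; simpa using hx
  | add f g hf hg => simp [hf, hg, add_smul]
  | mul f g hf hg => 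
    rw [map_mul, mul_apply_eq_comp, hg, map_smul, hf, smul_smul, ContinuousMap.mul_apply,
      Complex.ofReal_mul, mul_comm]
  | frequently f hf =>
    have hc : IsClosed {g : C(spectrum ℝ T, ℝ) | cfcHom hT g x = (g ⟨l, hl⟩ : ℂ) • x} := by
      refine isClosed_eq ?_ ?_
      · exact (ContinuousLinearMap.apply ℂ H x).continuous.comp (cfcHom_continuous hT)
      · exact (Complex.continuous_ofReal.comp (continuous_eval_const _)).smul
          continuous_const
    exact hc.mem_of_frequently_of_tendsto hf tendsto_id

end Traces

section EntropyBounds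

/-- The derivative of `s` on `(0,1)`. -/
def entropyDeriv (kB x : ℝ) : ℝ := kB * (Real.log (1 - x) - Real.log x)

theorem s_eq_mul_binEntropy (kB : ℝ) : s kB = fun x => kB * Real.binEntropy x := by
  ext x
  simp only [s, Real.binEntropy, Real.log_inv]
  ring

theorem continuous_s (kB : ℝ) : Continuous (s kB) := by
  rw [s_eq_mul_binEntropy]
  exact continuous_const.mul Real.binEntropy_continuous

theorem s_zero (kB : ℝ) : s kB 0 = 0 := by simp [s]

theorem s_nonneg {kB x : ℝ} (hkB : 0 < kB) (hx : x ∈ Set.Icc (0 : ℝ) 1) : 0 ≤ s kB x := by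
  rw [s_eq_mul_binEntropy]
  exact mul_nonneg hkB.le (Real.binEntropy_nonneg hx.1 hx.2)

theorem deriv_s (kB : ℝ) : deriv (s kB) = entropyDeriv kB := by
  ext x
  rw [s_eq_mul_binEntropy, deriv_const_mul_field, Real.deriv_binEntropy, entropyDeriv]

theorem mul_log_sub_log_le {x y : ℝ} (hx : 0 ≤ x) (hy : 0 < y) :
    x * (Real.log y - Real.log x) ≤ y - x := by
  rcases hx.eq_or_lt with rfl | hx
  · simpa using hy.le
  · rw [← Real.log_div hy.ne' hx.ne']
    calc x * Real.log (y / x) ≤ x * (y / x - 1) := by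
          gcongr; exact Real.log_le_sub_one_of_pos (by positivity)
      _ = y - x := by field_simp

/-- The concave function `s` lies below its tangents. -/
theorem s_le_tangent {kB x y : ℝ} (hkB : 0 < kB) (hx : x ∈ Set.Icc (0 : ℝ) 1)
    (hy : y ∈ Set.Ioo (0 : ℝ) 1) : s kB x ≤ s kB y + entropyDeriv kB y * (x - y) := by
  have h1 := mul_log_sub_log_le hx.1 hy.1
  have h2 := mul_log_sub_log_le (sub_nonneg.2 hx.2) (sub_pos.2 hy.2)
  have h3 := mul_le_mul_of_nonneg_left (add_le_add h1 h2) hkB.le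
  simp only [s, entropyDeriv]
  nlinarith

theorem one_div_exp_add_one_mem (w : ℝ) : 1 / (Real.exp w + 1) ∈ Set.Ioo (0 : ℝ) 1 := by
  have := Real.exp_pos w
  refine ⟨by positivity, ?_⟩
  rw [div_lt_one (by positivity)]
  linarith

theorem entropyDeriv_one_div {kB : ℝ} (hkB : 0 < kB) (z : ℝ) :
    entropyDeriv kB (1 / (Real.exp (z / kB) + 1)) = z := by
  have := Real.exp_pos (z / kB)
  have h : 1 - 1 / (Real.exp (z / kB) + 1) = Real.exp (z / kB) / (Real.exp (z / kB) + 1) := by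
    field_simp; ring
  rw [entropyDeriv, h, Real.log_div this.ne' (by positivity),
    Real.log_div one_ne_zero (by positivity), Real.log_exp, Real.log_one]
  field_simp; ring

theorem exp_entropyDeriv {kB x : ℝ} (hkB : 0 < kB) (hx : x ∈ Set.Ioo (0 : ℝ) 1) :
    Real.exp (entropyDeriv kB x / kB) = (1 - x) / x := by
  rw [entropyDeriv, mul_div_cancel_left₀ _ hkB.ne', Real.exp_sub, Real.exp_log hx.1,
    Real.exp_log (sub_pos.2 hx.2)]

theorem one_div_entropyDeriv {kB x : ℝ} (hkB : 0 < kB) (hx : x ∈ Set.Ioo (0 : ℝ) 1) :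
    1 / (Real.exp (entropyDeriv kB x / kB) + 1) = x := by
  have := hx.1
  rw [exp_entropyDeriv hkB hx]
  field_simp; ring

theorem bijOn_deriv_s {kB : ℝ} (hkB : 0 < kB) :
    Set.BijOn (deriv (s kB)) (Set.Ioo 0 1) Set.univ := by
  rw [deriv_s]
  refine ⟨Set.mapsTo_univ _ _, fun x hx y hy h => ?_, fun z _ => ?_⟩
  · rw [← one_div_entropyDeriv hkB hx, h, one_div_entropyDeriv hkB hy]
  · exact ⟨_, one_div_exp_add_one_mem _, entropyDeriv_one_div hkB z⟩

theorem sDerivInv_eq {kB : ℝ} (hkB : 0 < kB) (z : ℝ) :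
    sDerivInv kB z = 1 / (Real.exp (z / kB) + 1) := by
  have h : ∃ x ∈ Set.Ioo (0 : ℝ) 1, deriv (s kB) x = z :=
    (bijOn_deriv_s hkB).surjOn (Set.mem_univ z)
  have h1 : sDerivInv kB z ∈ Set.Ioo (0 : ℝ) 1 := Function.invFunOn_mem h
  have h2 : deriv (s kB) (sDerivInv kB z) = z := Function.invFunOn_eq h
  rw [deriv_s] at h2
  rw [← one_div_entropyDeriv hkB h1, h2]

theorem entropyDeriv_le {kB x y : ℝ} (hkB : 0 < kB) (hx : 0 < x) (hxy : x ≤ y) (hy : y < 1) :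
    entropyDeriv kB y ≤ entropyDeriv kB x := by
  have h1 := Real.log_le_log hx hxy
  have h2 := Real.log_le_log (sub_pos.2 hy) (sub_le_sub_left hxy 1)
  unfold entropyDeriv
  gcongr

/-- The derivative of `s`, cut off to a continuous function. -/
def truncatedDeriv (kB r ε x : ℝ) : ℝ := entropyDeriv kB (max ε (min x r))

theorem continuous_truncatedDeriv {r ε : ℝ} (kB : ℝ) (hε : 0 < ε) (hr : max ε r < 1) :
    Continuous (truncatedDeriv kB r ε) := by
  have h1 : ∀ x, max ε (min x r) ≠ 0 := fun x => (lt_max_of_lt_left hε).ne'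
  have h2 : ∀ x, 1 - max ε (min x r) ≠ 0 := fun x => by
    have : max ε (min x r) ≤ max ε r := max_le_max le_rfl (min_le_right _ _)
    linarith
  unfold truncatedDeriv entropyDeriv
  fun_prop (disch := simp_all)

theorem truncatedDeriv_le {kB r ε x : ℝ} (hkB : 0 < kB) (hx : x ∈ Set.Ioc 0 r)
    (hr : max ε r < 1) : truncatedDeriv kB r ε x ≤ entropyDeriv kB x := by
  rw [truncatedDeriv, min_eq_left hx.2]
  exact entropyDeriv_le hkB hx.1 (le_max_right _ _)
    (lt_of_le_of_lt (max_le_max le_rfl hx.2) hr)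

theorem truncatedDeriv_eq {kB r ε x : ℝ} (hx : x ∈ Set.Icc ε r) :
    truncatedDeriv kB r ε x = entropyDeriv kB x := by
  rw [truncatedDeriv, min_eq_left hx.2, max_eq_right hx.1]

variable {H : Type} [NormedAddCommGroup H] [InnerProductSpace ℂ H] [CompleteSpace H]

theorem spectrum_subset_Icc {T : H →L[ℂ] H} (hT : T.IsPositive) {r : ℝ}
    (hr : ∀ x, quad T x ≤ r * ‖x‖ ^ 2) : spectrum ℝ T ⊆ Set.Icc 0 r := by
  have h0 : 0 ≤ T := (ContinuousLinearMap.nonneg_iff_isPositive T).2 hT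
  have h1 : T ≤ algebraMap ℝ (H →L[ℂ] H) r := by
    refine le_of_quad_le hT.isSelfAdjoint (IsSelfAdjoint.algebraMap _ (.all r)) fun x => ?_
    have : algebraMap ℝ (H →L[ℂ] H) r = ((r : ℂ) • 1 : H →L[ℂ] H) := by
      ext; simp [Algebra.algebraMap_eq_smul_one]
    rw [this, quad_smul, quad_one]
    exact hr x
  intro x hx
  exact ⟨spectrum_nonneg_of_nonneg h0 hx, (le_algebraMap_iff_spectrum_le hT.isSelfAdjoint).1 h1 x hx⟩

theorem quad_le_of_isPositive_one_sub {T : H →L[ℂ] H} (hT : (1 - T).IsPositive) (x : H) :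
    quad T x ≤ 1 * ‖x‖ ^ 2 := by
  have := quad_nonneg hT x
  rw [quad_sub, quad_one] at this
  linarith

theorem isPositive_one_sub {T : H →L[ℂ] H} (hT : IsSelfAdjoint T)
    (h : ∀ x, quad T x ≤ 1 * ‖x‖ ^ 2) : (1 - T).IsPositive := by
  rw [← ContinuousLinearMap.le_def]
  exact le_of_quad_le hT (IsSelfAdjoint.one _) fun x => by simpa [quad_one] using h x

theorem apply_eq_zero_of_quad_eq_zero {T : H →L[ℂ] H} (hT : T.IsPositive) {x : H}
    (h : quad T x = 0) : T x = 0 := by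
  obtain ⟨R, hR, rfl⟩ := exists_sqrt hT
  rw [quad_mul_self hR] at h
  have : R x = 0 := by simpa using h
  simp [mul_apply_eq_comp, this]

/-- Klein's inequality for the entropy. -/
theorem quad_cfc_s_le {kB y : ℝ} (hkB : 0 < kB) {T : H →L[ℂ] H} (hT : T.IsPositive)
    (hT1 : (1 - T).IsPositive) (hy : y ∈ Set.Ioo (0 : ℝ) 1) (u : H) :
    quad (cfc (s kB) T) u ≤
      (s kB y - entropyDeriv kB y * y) * ‖u‖ ^ 2 + entropyDeriv kB y * quad T u := by
  have hsp := spectrum_subset_Icc hT (quad_le_of_isPositive_one_sub hT1)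
  have h1 : cfc (s kB) T ≤
      cfc (fun x => (s kB y - entropyDeriv kB y * y) + entropyDeriv kB y * x) T := by
    refine cfc_mono (fun x hx => ?_) (continuous_s kB).continuousOn (by fun_prop)
    have := s_le_tangent hkB (hsp hx) hy
    linarith
  have hsa := hT.isSelfAdjoint
  rw [cfc_const_add _ _ _ (by fun_prop) hsa, cfc_const_mul_id _ _ hsa] at h1
  refine (quad_mono h1 u).trans_eq ?_
  have e1 : ∀ r : ℝ, algebraMap ℝ (H →L[ℂ] H) r = ((r : ℂ) • 1 : H →L[ℂ] H) := fun r => by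
    ext; simp [Algebra.algebraMap_eq_smul_one]
  have e2 : entropyDeriv kB y • T = (entropyDeriv kB y : ℂ) • T := by
    ext; simp
  rw [e1, e2, quad_add, quad_smul, quad_smul, quad_one]

theorem isPositive_cfc_s {kB : ℝ} (hkB : 0 < kB) {T : H →L[ℂ] H} (hT : T.IsPositive)
    (hT1 : (1 - T).IsPositive) : (cfc (s kB) T).IsPositive := by
  rw [← ContinuousLinearMap.nonneg_iff_isPositive]
  exact cfc_nonneg fun x hx =>
    s_nonneg hkB (spectrum_subset_Icc hT (quad_le_of_isPositive_one_sub hT1) hx)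

theorem continuous_tsum_quad {ι : Type} {y : ι → H} (hy : Summable fun i => ‖y i‖ ^ 2) :
    Continuous fun G : H →L[ℂ] H => ∑' i, quad G (y i) := by
  have hs : ∀ G : H →L[ℂ] H, Summable fun i => quad G (y i) := fun G =>
    Summable.of_norm_bounded (hy.mul_left ‖G‖) fun i => abs_quad_le G (y i)
  refine (LipschitzWith.of_dist_le_mul (K := (∑' i, ‖y i‖ ^ 2).toNNReal) fun G G' => ?_).continuous
  rw [Real.coe_toNNReal _ (tsum_nonneg fun _ => by positivity), Real.dist_eq, dist_eq_norm,
    ← (hs G).tsum_sub (hs G'), mul_comm, ← tsum_mul_left]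
  simp_rw [← quad_sub]
  exact tsum_of_norm_bounded (f := fun i => quad (G - G') (y i)) (hy.mul_left ‖G - G'‖).hasSum
    fun i => abs_quad_le (G - G') (y i)

theorem hasSum_entropy {kB : ℝ} {ι : Type} {b : HilbertBasis ι ℂ H} {T : H →L[ℂ] H} {l : ι → ℝ}
    (hT : IsSelfAdjoint T) (hb : ∀ i, T (b i) = (l i : ℂ) • b i)
    (hs : IsTraceClass (cfc (s kB) T)) : HasSum (fun i => s kB (l i)) (entropy kB T) := by
  refine (hs.hasSum_quad b).congr_fun fun i => ?_
  rw [quad_eigenvector (cfc_apply_eigenvector hT (hb i) (continuous_s kB).continuousOn),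
    b.orthonormal.1 i]
  simp

/-- A lower bound for the entropy of a positive perturbation. -/
theorem entropy_add_tsum_le {kB t r : ℝ} (hkB : 0 < kB) (ht : 0 ≤ t) (hr : r < 1)
    {ρ δ R : H →L[ℂ] H}
    (hρ : ρ.IsPositive) (hρ1 : (1 - ρ).IsPositive) (htr : IsTraceClass ρ)
    (hρs : IsTraceClass (cfc (s kB) ρ)) (hR : IsSelfAdjoint R) (hδ : R * R = δ)
    (hδt : IsTraceClass δ) (hσr : ∀ x, quad (ρ + (t : ℂ) • δ) x ≤ r * ‖x‖ ^ 2)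
    (hσs : IsTraceClass (cfc (s kB) (ρ + (t : ℂ) • δ)))
    {g : ℝ → ℝ} (hg : Continuous g) (hgle : ∀ x ∈ Set.Ioc 0 r, g x ≤ entropyDeriv kB x)
    {ι : Type} (b : HilbertBasis ι ℂ H) :
    entropy kB ρ + t * ∑' i, quad (cfc g (ρ + (t : ℂ) • δ)) (R (b i)) ≤
      entropy kB (ρ + (t : ℂ) • δ) := by
  have hδp : δ.IsPositive := by
    rw [← hδ]
    have := ContinuousLinearMap.isPositive_adjoint_comp_self R
    rwa [ContinuousLinearMap.isSelfAdjoint_iff'.1 hR] at this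
  set σ := ρ + (t : ℂ) • δ with hσ
  have hσp : σ.IsPositive := hρ.add (hδp.smul_of_nonneg (by exact_mod_cast ht))
  have hσt : IsTraceClass σ := (htr.add (hδt.smul t).1).1
  obtain ⟨κ, f, k, hf⟩ := exists_eigenbasis hσp hσt
  have hk : ∀ j, k j = quad ρ (f j) + t * quad δ (f j) := fun j => by
    have h := quad_eigenvector (hf j)
    rw [f.orthonormal.1 j, hσ, quad_add, quad_smul] at h
    linarith
  have hkr : ∀ j, k j ≤ r := fun j => by
    have h := hσr (f j)
    rw [quad_eigenvector (hf j), f.orthonormal.1 j] at h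
    linarith
  have h1 := hρs.hasSum_quad f
  have h2 := hasSum_entropy hσp.isSelfAdjoint hf hσs
  have h3 : HasSum (fun j => g (k j) * quad δ (f j)) (∑' i, quad (cfc g σ) (R (b i))) := by
    rw [← hδ]
    refine hasSum_eigenvalue_mul_quad b hR (IsSelfAdjoint.cfc (f := g)) (fun j => ?_) ?_
    · exact cfc_apply_eigenvector hσp.isSelfAdjoint (hf j) hg.continuousOn
    · rw [hδ]; exact (hδt.hasSum_quad b).summable
  have h4 : ∀ j, quad (cfc (s kB) ρ) (f j) ≤ s kB (k j) - t * (g (k j) * quad δ (f j)) := by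
    intro j
    have q1 := quad_nonneg hρ (f j)
    have q2 := mul_nonneg ht (quad_nonneg hδp (f j))
    rcases (show 0 ≤ k j by rw [hk]; positivity).eq_or_lt with h0 | h0
    · have e1 : quad ρ (f j) = 0 := by linarith [hk j]
      have e2 : t * quad δ (f j) = 0 := by linarith [hk j]
      have e3 : ρ (f j) = ((0 : ℝ) : ℂ) • f j := by
        rw [apply_eq_zero_of_quad_eq_zero hρ e1]; simp
      rw [quad_eigenvector (cfc_apply_eigenvector hρ.isSelfAdjoint e3
        (continuous_s kB).continuousOn), ← h0, mul_left_comm, e2, s_zero]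
      simp
    · have e1 := quad_cfc_s_le hkB hρ hρ1 ⟨h0, (hkr j).trans_lt hr⟩ (f j)
      rw [f.orthonormal.1 j] at e1
      have e2 := mul_le_mul_of_nonneg_right (hgle (k j) ⟨h0, hkr j⟩) q2
      have e3 : quad ρ (f j) = k j - t * quad δ (f j) := by linarith [hk j]
      rw [e3] at e1
      nlinarith
  have h5 := hasSum_le h4 h1 (h2.sub (h3.mul_left t))
  have h6 : entropy kB ρ = (trace (cfc (s kB) ρ)).re := rfl
  linarith

/-- The lower right derivative of the entropy in the direction of a positive operator. -/
theorem eventually_entropy_add_mul_le {kB r a : ℝ} (hkB : 0 < kB) (hr : r < 1)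
    {ρ δ : H →L[ℂ] H} (hρ : ρ.IsPositive) (htr : IsTraceClass ρ)
    (hρr : ∀ x, quad ρ x ≤ r * ‖x‖ ^ 2) (hρs : IsTraceClass (cfc (s kB) ρ))
    (hδp : δ.IsPositive) (hδt : IsTraceClass δ)
    (hσr : ∀ᶠ t : ℝ in 𝓝[>] 0, ∀ x, quad (ρ + (t : ℂ) • δ) x ≤ r * ‖x‖ ^ 2)
    (hσs : ∀ᶠ t : ℝ in 𝓝[>] 0, IsTraceClass (cfc (s kB) (ρ + (t : ℂ) • δ)))
    {g : ℝ → ℝ} (hg : Continuous g) (hgle : ∀ x ∈ Set.Ioc 0 r, g x ≤ entropyDeriv kB x)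
    {ι : Type} {b : HilbertBasis ι ℂ H} {l : ι → ℝ} (hb : ∀ i, ρ (b i) = (l i : ℂ) • b i)
    (ha : a < ∑' i, g (l i) * quad δ (b i)) :
    ∀ᶠ t : ℝ in 𝓝[>] 0, entropy kB ρ + t * a ≤ entropy kB (ρ + (t : ℂ) • δ) := by
  obtain ⟨R, hR, hRδ⟩ := exists_sqrt hδp
  have hbs := (hδt.hasSum_quad b).summable
  have hsum : Summable fun i => ‖R (b i)‖ ^ 2 := by
    simp_rw [← quad_mul_self hR, hRδ]; exact hbs
  have h1 : ∑' i, g (l i) * quad δ (b i) = ∑' i, quad (cfc g ρ) (R (b i)) := by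
    rw [← hRδ]
    refine (hasSum_eigenvalue_mul_quad b hR (IsSelfAdjoint.cfc (f := g)) (fun j => ?_)
      (by rwa [hRδ])).tsum_eq
    exact cfc_apply_eigenvector hρ.isSelfAdjoint (hb j) hg.continuousOn
  have hpos : ∀ᶠ t : ℝ in 𝓝[>] 0, (0 : ℝ) < t := eventually_mem_nhdsWithin
  have hσp : ∀ t : ℝ, 0 < t → (ρ + (t : ℂ) • δ).IsPositive := fun t ht =>
    hρ.add (hδp.smul_of_nonneg (by exact_mod_cast ht.le))
  have hlim : Tendsto (fun t : ℝ => ρ + (t : ℂ) • δ) (𝓝[>] 0) (𝓝 ρ) := by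
    have : Continuous fun t : ℝ => ρ + (t : ℂ) • δ := by fun_prop
    have h := this.tendsto 0
    simp only [Complex.ofReal_zero, zero_smul, add_zero] at h
    exact h.mono_left nhdsWithin_le_nhds
  have h2 : Tendsto (fun t : ℝ => cfc g (ρ + (t : ℂ) • δ)) (𝓝[>] 0) (𝓝 (cfc g ρ)) := by
    refine hlim.cfc (isCompact_Icc (a := 0) (b := r)) g ?_ ?_ (spectrum_subset_Icc hρ hρr)
      hρ.isSelfAdjoint hg.continuousOn
    · filter_upwards [hpos, hσr] with t ht h
      exact spectrum_subset_Icc (hσp t ht) h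
    · filter_upwards [hpos] with t ht
      exact (hσp t ht).isSelfAdjoint
  have h3 := ((continuous_tsum_quad hsum).tendsto _).comp h2
  rw [← h1] at h3
  have hρ1 : (1 - ρ).IsPositive := isPositive_one_sub hρ.isSelfAdjoint fun x =>
    (hρr x).trans (by gcongr)
  filter_upwards [hpos, hσr, hσs, h3.eventually_const_lt ha] with t ht hr' hs' ha'
  refine le_trans ?_
    (entropy_add_tsum_le hkB ht.le hr hρ hρ1 htr hρs hR hRδ hδt hr' hs' hg hgle b)
  have := mul_le_mul_of_nonneg_left ha'.le ht.le
  simp only [Function.comp_apply] at this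
  linarith

end EntropyBounds

section EntropyDerivative

variable {H : Type} [NormedAddCommGroup H] [InnerProductSpace ℂ H] [CompleteSpace H]

theorem inner_map_left {A : H →ₗ.[ℂ] H} (hA : IsSelfAdjoint A) (x y : A.domain) :
    ⟪A x, (y : H)⟫_ℂ = ⟪(x : H), A y⟫_ℂ := by
  have h := LinearPMap.adjoint_isFormalAdjoint hA.dense_domain
  rw [(LinearPMap.isSelfAdjoint_def.1 hA : LinearPMap.adjoint A = A)] at h
  exact h x y

theorem expectation_eq {A : H →ₗ.[ℂ] H} {ρ T : H →L[ℂ] H} (hT : IsProduct A ρ T)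
    (ht : IsTraceClass T) : expectation A ρ = trace T := by
  have h : HasExpectation A ρ := ⟨T, hT, ht⟩
  have e : h.choose = T := by
    ext u
    obtain ⟨h1, e1⟩ := h.choose_spec.1 u
    obtain ⟨h2, e2⟩ := hT u
    rw [e1, e2]
  rw [expectation, dif_pos h, e]

theorem HasExpectation.add_smul {A : H →ₗ.[ℂ] H} {ρ δ : H →L[ℂ] H} (hρ : HasExpectation A ρ)
    (hδ : HasExpectation A δ) (c : ℂ) :
    HasExpectation A (ρ + c • δ) ∧
      expectation A (ρ + c • δ) = expectation A ρ + c * expectation A δ := by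
  obtain ⟨S, hS, hSt⟩ := hρ
  obtain ⟨T, hT, hTt⟩ := hδ
  have hP : IsProduct A (ρ + c • δ) (S + c • T) := fun u => by
    obtain ⟨h1, e1⟩ := hS u
    obtain ⟨h2, e2⟩ := hT u
    refine ⟨A.domain.add_mem h1 (A.domain.smul_mem c h2), ?_⟩
    have : (⟨(ρ + c • δ) u, A.domain.add_mem h1 (A.domain.smul_mem c h2)⟩ : A.domain) =
      ⟨ρ u, h1⟩ + c • ⟨δ u, h2⟩ := rfl
    rw [this, LinearPMap.map_add, LinearPMap.map_smul, ← e1, ← e2]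
    rfl
  have ht := hSt.add (hTt.smul c).1
  refine ⟨⟨_, hP, ht.1⟩, ?_⟩
  rw [expectation_eq hP ht.1, ht.2, (hTt.smul c).2, expectation_eq hS hSt, expectation_eq hT hTt]

theorem hasSum_re_expectation {A : H →ₗ.[ℂ] H} (hA : IsSelfAdjoint A) {ι : Type}
    {b : HilbertBasis ι ℂ H} {a : ι → ℝ}
    (hb : ∀ i, ∃ h : b i ∈ A.domain, A ⟨b i, h⟩ = (a i : ℂ) • b i) {ρ : H →L[ℂ] H}
    (hρ : HasExpectation A ρ) :
    HasSum (fun i => a i * quad ρ (b i)) (expectation A ρ).re := by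
  obtain ⟨T, hT, hTt⟩ := hρ
  rw [expectation_eq hT hTt]
  refine (hTt.hasSum_quad b).congr_fun fun i => ?_
  obtain ⟨h1, e1⟩ := hT (b i)
  obtain ⟨h2, e2⟩ := hb i
  have := inner_map_left hA ⟨b i, h2⟩ ⟨ρ (b i), h1⟩
  rw [e2, inner_smul_left] at this
  simp only [quad, e1]
  rw [← this, Complex.conj_ofReal, Complex.re_ofReal_mul]

theorem hasTrace_rankOne (x y : H) : HasTrace (InnerProductSpace.rankOne ℂ x y) ⟪y, x⟫_ℂ := by
  intro ι b
  refine (b.hasSum_inner_mul_inner y x).congr_fun fun i => ?_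
  rw [InnerProductSpace.rankOne_apply, inner_smul_right]

theorem hasExpectation_rankOne {A : H →ₗ.[ℂ] H} (φ : A.domain) :
    HasExpectation A (InnerProductSpace.rankOne ℂ (φ : H) (φ : H)) ∧
      expectation A (InnerProductSpace.rankOne ℂ (φ : H) (φ : H)) = ⟪(φ : H), A φ⟫_ℂ := by
  have hP : IsProduct A (InnerProductSpace.rankOne ℂ (φ : H) (φ : H))
      (InnerProductSpace.rankOne ℂ (A φ) (φ : H)) := fun u => by
    refine ⟨A.domain.smul_mem _ φ.2, ?_⟩
    have : (⟨InnerProductSpace.rankOne ℂ (φ : H) (φ : H) u, A.domain.smul_mem _ φ.2⟩ : A.domain) =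
      ⟪(φ : H), u⟫_ℂ • φ := rfl
    rw [this, LinearPMap.map_smul]
    rfl
  have ht := hasTrace_rankOne (A φ) (φ : H)
  exact ⟨⟨_, hP, _, ht⟩, by rw [expectation_eq hP ⟨_, ht⟩, ht.trace_eq]⟩

theorem quad_rankOne (φ x : H) :
    quad (InnerProductSpace.rankOne ℂ φ φ) x = ‖⟪x, φ⟫_ℂ‖ ^ 2 := by
  rw [quad, InnerProductSpace.rankOne_apply, inner_smul_right, ← inner_conj_symm φ x,
    ← Complex.normSq_eq_conj_mul_self, Complex.normSq_eq_norm_sq]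
  norm_cast

theorem exists_quad_le {ι : Type} {b : HilbertBasis ι ℂ H} {ρ : H →L[ℂ] H} {l : ι → ℝ}
    (hρ : ρ.IsPositive) (htr : IsTraceClass ρ) (hb : ∀ i, ρ (b i) = (l i : ℂ) • b i)
    (hl : ∀ i, l i < 1) : ∃ r, 0 < r ∧ r < 1 ∧ (∀ i, l i ≤ r) ∧ ∀ x, quad ρ x ≤ r * ‖x‖ ^ 2 := by
  have hq : ∀ i, quad ρ (b i) = l i := fun i => by
    rw [quad_eigenvector (hb i), b.orthonormal.1 i]; simp
  have hs : Summable l := by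
    simpa only [hq] using (htr.hasSum_quad b).summable
  have hfin : {i | ¬ l i < 1 / 2}.Finite :=
    hs.tendsto_cofinite_zero.eventually (eventually_lt_nhds (by norm_num))
  have h1 : ∀ᶠ r : ℝ in 𝓝[<] 1, ∀ i ∈ {i | ¬ l i < 1 / 2}, l i < r :=
    (Filter.eventually_all_finite hfin).2 fun i _ =>
      (eventually_gt_nhds (hl i)).filter_mono nhdsWithin_le_nhds
  have h2 : ∀ᶠ r : ℝ in 𝓝[<] 1, 1 / 2 < r :=
    (eventually_gt_nhds (by norm_num)).filter_mono nhdsWithin_le_nhds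
  obtain ⟨r, hr1, hr2, hr3⟩ := (h1.and (h2.and eventually_mem_nhdsWithin)).exists
  have hlr : ∀ i, l i ≤ r := fun i => by
    by_cases h : l i < 1 / 2
    · linarith
    · exact (hr1 i h).le
  refine ⟨r, by linarith, hr3, hlr, fun x => ?_⟩
  refine hasSum_le (fun i => ?_) (hasSum_eigenvalue_mul_norm_inner_sq hρ.isSelfAdjoint hb x)
    ((hasSum_norm_inner_sq b x).mul_left r)
  gcongr
  exact hlr i

theorem eventually_quad_add_le {ρ : H →L[ℂ] H} (δ : H →L[ℂ] H) {r r' : ℝ} (hr : r < r')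
    (hρ : ∀ x, quad ρ x ≤ r * ‖x‖ ^ 2) :
    ∀ᶠ t : ℝ in 𝓝[>] 0, ∀ x, quad (ρ + (t : ℂ) • δ) x ≤ r' * ‖x‖ ^ 2 := by
  have h : ∀ᶠ t : ℝ in 𝓝[>] 0, t * ‖δ‖ < r' - r := by
    have : Tendsto (fun t : ℝ => t * ‖δ‖) (𝓝 0) (𝓝 (0 * ‖δ‖)) :=
      (continuous_id.mul continuous_const).tendsto 0
    rw [zero_mul] at this
    exact (this.eventually_lt_const (sub_pos.2 hr)).filter_mono nhdsWithin_le_nhds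
  filter_upwards [h, eventually_mem_nhdsWithin] with t ht ht0 x
  have h1 := (abs_le.1 (abs_quad_le δ x)).2
  have h2 := mul_le_mul_of_nonneg_left h1 (le_of_lt ht0 : (0 : ℝ) ≤ t)
  have h3 := mul_le_mul_of_nonneg_right ht.le (sq_nonneg ‖x‖)
  rw [quad_add, quad_smul]
  nlinarith [hρ x]

theorem tendsto_tsum_truncatedDeriv {kB r α : ℝ} (hkB : 0 < kB) (hr0 : 0 < r) (hr : r < 1)
    {ι : Type} {l q : ι → ℝ}
    (hl : ∀ i, l i ∈ Set.Ioc 0 r) (hq : ∀ i, 0 ≤ q i) (hqs : Summable q)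
    (hα : HasSum (fun i => entropyDeriv kB (l i) * q i) α) :
    Tendsto (fun ε : ℝ => ∑' i, truncatedDeriv kB r ε (l i) * q i) (𝓝[>] 0) (𝓝 α) := by
  rw [← hα.tsum_eq]
  refine tendsto_tsum_of_dominated_convergence
    (bound := fun i => |entropyDeriv kB (l i) * q i| + |entropyDeriv kB r| * q i)
    (hα.summable.abs.add (hqs.mul_left _)) (fun i => ?_) ?_
  · refine tendsto_const_nhds.congr' ?_
    have h : ∀ᶠ ε : ℝ in 𝓝[>] 0, ε < l i :=
      (eventually_lt_nhds (hl i).1).filter_mono nhdsWithin_le_nhds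
    filter_upwards [h] with ε hε
    rw [truncatedDeriv_eq ⟨hε.le, (hl i).2⟩]
  · have h : ∀ᶠ ε : ℝ in 𝓝[>] 0, ε < r :=
      (eventually_lt_nhds hr0).filter_mono nhdsWithin_le_nhds
    filter_upwards [h, eventually_mem_nhdsWithin] with ε hε hε0 i
    have hm : max ε r < 1 := by rw [max_eq_right hε.le]; exact hr
    have h1 := truncatedDeriv_le (ε := ε) hkB (hl i) hm
    have h2 : entropyDeriv kB r ≤ truncatedDeriv kB r ε (l i) :=
      entropyDeriv_le hkB (lt_max_of_lt_left hε0) (max_le hε.le (min_le_right _ _)) hr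
    rw [Real.norm_eq_abs, abs_mul, abs_mul, abs_of_nonneg (hq i), ← add_mul]
    refine mul_le_mul_of_nonneg_right ?_ (hq i)
    refine abs_le.2 ⟨?_, ?_⟩
    · linarith [neg_abs_le (entropyDeriv kB r), abs_nonneg (entropyDeriv kB (l i))]
    · linarith [le_abs_self (entropyDeriv kB (l i)), abs_nonneg (entropyDeriv kB r)]

theorem entropy_le_of_hasSum {kB α : ℝ} (hkB : 0 < kB) {ι : Type} {b : HilbertBasis ι ℂ H}
    {ρ σ : H →L[ℂ] H} {l : ι → ℝ} (hρ : ρ.IsPositive) (hb : ∀ i, ρ (b i) = (l i : ℂ) • b i)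
    (hl : ∀ i, l i ∈ Set.Ioo (0 : ℝ) 1) (hρs : IsTraceClass (cfc (s kB) ρ))
    (hσ : σ.IsPositive) (hσ1 : (1 - σ).IsPositive)
    (hα : HasSum (fun i => entropyDeriv kB (l i) * (quad σ (b i) - l i)) α) :
    IsTraceClass (cfc (s kB) σ) ∧ entropy kB σ ≤ entropy kB ρ + α := by
  have h1 := (hasSum_entropy hρ.isSelfAdjoint hb hρs).add hα
  have h2 : ∀ i, quad (cfc (s kB) σ) (b i) ≤
      s kB (l i) + entropyDeriv kB (l i) * (quad σ (b i) - l i) := fun i => by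
    have := quad_cfc_s_le hkB hσ hσ1 (hl i) (b i)
    rw [b.orthonormal.1 i] at this
    linarith
  have hp := isPositive_cfc_s hkB hσ hσ1
  have h3 : IsTraceClass (cfc (s kB) σ) := ⟨_, hasTrace_of_isPositive hp b
    (Summable.of_nonneg_of_le (fun i => quad_nonneg hp _) h2 h1.summable)⟩
  exact ⟨h3, hasSum_le h2 (h3.hasSum_quad b) h1⟩

/-- The right derivative of the entropy in the direction of a positive operator. -/
theorem hasDerivWithinAt_entropy {kB α : ℝ} (hkB : 0 < kB) {ι : Type} {b : HilbertBasis ι ℂ H}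
    {ρ δ : H →L[ℂ] H} {l : ι → ℝ} (hρ : ρ.IsPositive) (htr : IsTraceClass ρ)
    (hb : ∀ i, ρ (b i) = (l i : ℂ) • b i)
    (hl : ∀ i, l i ∈ Set.Ioo (0 : ℝ) 1) (hρs : IsTraceClass (cfc (s kB) ρ))
    (hδ : δ.IsPositive) (hδt : IsTraceClass δ)
    (hα : HasSum (fun i => entropyDeriv kB (l i) * quad δ (b i)) α) :
    (∀ᶠ t : ℝ in 𝓝[>] 0, (1 - (ρ + (t : ℂ) • δ)).IsPositive ∧
      IsTraceClass (cfc (s kB) (ρ + (t : ℂ) • δ))) ∧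
    HasDerivWithinAt (fun t : ℝ => entropy kB (ρ + (t : ℂ) • δ)) α (Set.Ici 0) 0 := by
  obtain ⟨r, hr0, hr1, hlr, hρr⟩ := exists_quad_le hρ htr hb fun i => (hl i).2
  obtain ⟨r', hr', hr'1⟩ := exists_between hr1
  have hσr := eventually_quad_add_le δ hr' hρr
  have hpos : ∀ᶠ t : ℝ in 𝓝[>] 0, (0 : ℝ) < t := eventually_mem_nhdsWithin
  have hσp : ∀ t : ℝ, 0 < t → (ρ + (t : ℂ) • δ).IsPositive := fun t ht =>
    hρ.add (hδ.smul_of_nonneg (by exact_mod_cast ht.le))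
  have hq : ∀ i, quad ρ (b i) = l i := fun i => by
    rw [quad_eigenvector (hb i), b.orthonormal.1 i]; simp
  have h1 : ∀ᶠ t : ℝ in 𝓝[>] 0, (1 - (ρ + (t : ℂ) • δ)).IsPositive := by
    filter_upwards [hσr, hpos] with t ht ht0
    exact isPositive_one_sub (hσp t ht0).isSelfAdjoint fun x => (ht x).trans (by gcongr)
  have h2 : ∀ᶠ t : ℝ in 𝓝[>] 0, IsTraceClass (cfc (s kB) (ρ + (t : ℂ) • δ)) ∧
      entropy kB (ρ + (t : ℂ) • δ) ≤ entropy kB ρ + t * α := by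
    filter_upwards [h1, hpos] with t ht ht0
    refine entropy_le_of_hasSum hkB hρ hb hl hρs (hσp t ht0) ht ?_
    refine (hα.mul_left t).congr_fun fun i => ?_
    rw [quad_add, quad_smul, hq]
    ring
  have hσs := h2.mono fun _ h => h.1
  refine ⟨h1.and hσs, ?_⟩
  rw [← hasDerivWithinAt_Ioi_iff_Ici, hasDerivWithinAt_iff_tendsto_slope' (by simp)]
  refine tendsto_order.2 ⟨fun a ha => ?_, fun a ha => ?_⟩
  · obtain ⟨a', ha', ha'α⟩ := exists_between ha
    have hlim := tendsto_tsum_truncatedDeriv hkB (hr0.trans hr') hr'1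
      (fun i => ⟨(hl i).1, (hlr i).trans hr'.le⟩) (fun i => quad_nonneg hδ (b i))
      (hδt.hasSum_quad b).summable hα
    have hε : ∀ᶠ ε : ℝ in 𝓝[>] 0, ε < r' :=
      (eventually_lt_nhds (hr0.trans hr')).filter_mono nhdsWithin_le_nhds
    obtain ⟨ε, hε, hε0, hεa⟩ := (hε.and ((eventually_mem_nhdsWithin).and
      (hlim.eventually_const_lt ha'α))).exists
    have hm : max ε r' < 1 := by rw [max_eq_right hε.le]; exact hr'1
    have h3 := eventually_entropy_add_mul_le hkB hr'1 hρ htr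
      (fun x => (hρr x).trans (by gcongr)) hρs hδ hδt hσr hσs
      (continuous_truncatedDeriv kB hε0 hm) (fun x hx => truncatedDeriv_le hkB hx hm) hb hεa
    filter_upwards [h3, hpos] with t ht ht0
    rw [slope_def_field]
    simp only [Complex.ofReal_zero, zero_smul, add_zero, sub_zero]
    rw [lt_div_iff₀ ht0]
    nlinarith
  · filter_upwards [h2, hpos] with t ht ht0
    rw [slope_def_field]
    simp only [Complex.ofReal_zero, zero_smul, add_zero, sub_zero]
    rw [div_lt_iff₀ ht0]
    nlinarith [ht.2]

end EntropyDerivative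

section Optimality

variable {H : Type} [NormedAddCommGroup H] [InnerProductSpace ℂ H] [CompleteSpace H]
  {d : ℕ} {kB c : ℝ} {Oε : H →ₗ.[ℂ] H} {Ov : Fin d → (H →ₗ.[ℂ] H)} {A : H →ₗ.[ℂ] H}
  {ρ δ : H →L[ℂ] H}

/-- The vectors `b i` are eigenvectors of `A`, with the eigenvalues `s' (l i)`. -/
def IsEntropyEigenbasis {ι : Type} (kB : ℝ) (A : H →ₗ.[ℂ] H) (b : HilbertBasis ι ℂ H)
    (l : ι → ℝ) : Prop :=
  (∀ i, l i ∈ Set.Ioo (0 : ℝ) 1) ∧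
    ∀ i, ∃ h : b i ∈ A.domain, A ⟨b i, h⟩ = (entropyDeriv kB (l i) : ℂ) • b i

theorem HasMoments.add_smul (hρ : HasMoments Oε Ov A ρ) (hδ : HasMoments Oε Ov A δ) {t : ℝ}
    (ht : 0 ≤ t) : HasMoments Oε Ov A (ρ + (t : ℂ) • δ) := by
  obtain ⟨h1, h2, h3, h4, h5⟩ := hρ
  obtain ⟨g1, g2, g3, g4, g5⟩ := hδ
  exact ⟨h1.add (g1.smul_of_nonneg (by exact_mod_cast ht)), (h2.add (g2.smul t).1).1,
    (h3.add_smul g3 t).1, fun i => ((h4 i).add_smul (g4 i) t).1, (h5.add_smul g5 t).1⟩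

theorem hasDerivWithinAt_lagrangian_iff (hρ : HasExpectation A ρ) (hδ : HasExpectation A δ)
    (β : ℝ) :
    HasDerivWithinAt (fun t : ℝ => entropy kB (ρ + (t : ℂ) • δ) -
        (expectation A (ρ + (t : ℂ) • δ)).re + c) β (Set.Ici 0) 0 ↔
      HasDerivWithinAt (fun t : ℝ => entropy kB (ρ + (t : ℂ) • δ)) (β + (expectation A δ).re)
        (Set.Ici 0) 0 := by
  have e : ∀ t : ℝ, (expectation A (ρ + (t : ℂ) • δ)).re =
      (expectation A ρ).re + t * (expectation A δ).re := fun t => by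
    rw [(hρ.add_smul hδ t).2, Complex.add_re, Complex.re_ofReal_mul]
  simp_rw [e]
  have h1 : HasDerivWithinAt (fun t : ℝ => (expectation A ρ).re + t * (expectation A δ).re)
      (expectation A δ).re (Set.Ici 0) 0 := by
    simpa using ((hasDerivWithinAt_id (0 : ℝ) (Set.Ici 0)).mul_const
      (expectation A δ).re).const_add (expectation A ρ).re
  constructor
  · intro h
    exact ((h.add h1).sub_const c).congr_of_eventuallyEq
      (.of_forall fun t => by simp only [Pi.add_apply]; ring) (by simp only [Pi.add_apply]; ring)
  · intro h
    have h2 := (h.sub h1).add_const c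
    rw [add_sub_cancel_right] at h2
    exact h2

theorem quad_basis {ι : Type} {b : HilbertBasis ι ℂ H} {l : ι → ℝ}
    (hb : ∀ i, ρ (b i) = (l i : ℂ) • b i) (i : ι) : quad ρ (b i) = l i := by
  rw [quad_eigenvector (hb i), b.orthonormal.1 i]; simp

theorem isFirstOrderOptimal_of_isEntropyEigenbasis (hkB : 0 < kB) (hA : IsSelfAdjoint A)
    (hρ : ρ ∈ lagrangianDomain kB Oε Ov A) {ι : Type} {b : HilbertBasis ι ℂ H} {l : ι → ℝ}
    (hb : ∀ i, ρ (b i) = (l i : ℂ) • b i) (hE : IsEntropyEigenbasis kB A b l) :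
    IsFirstOrderOptimal (fun σ => entropy kB σ - (expectation A σ).re + c)
      (lagrangianDomain kB Oε Ov A) (perturbations Oε Ov A) ρ := by
  intro δ hδ
  have hα := hasSum_re_expectation hA hE.2 hδ.1.2.2.2.2
  obtain ⟨h1, h2⟩ := hasDerivWithinAt_entropy hkB hρ.1.1 hρ.1.2.1 hb hE.1 hρ.2.2 hδ.1.1
    hδ.1.2.1 hα
  refine ⟨?_, ?_⟩
  · filter_upwards [h1, eventually_mem_nhdsWithin] with t ht ht0
    exact ⟨hρ.1.add_smul hδ.1 (le_of_lt ht0), ht⟩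
  · rw [hasDerivWithinAt_lagrangian_iff hρ.1.2.2.2.2 hδ.1.2.2.2.2, zero_add]
    exact h2

theorem isMaxOn_of_isEntropyEigenbasis (hkB : 0 < kB) (hA : IsSelfAdjoint A)
    (hρ : ρ ∈ lagrangianDomain kB Oε Ov A) {ι : Type} {b : HilbertBasis ι ℂ H} {l : ι → ℝ}
    (hb : ∀ i, ρ (b i) = (l i : ℂ) • b i) (hE : IsEntropyEigenbasis kB A b l) :
    IsMaxOn (fun σ => entropy kB σ - (expectation A σ).re + c) (lagrangianDomain kB Oε Ov A) ρ := by
  intro σ hσ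
  have h1 := hasSum_re_expectation hA hE.2 hσ.1.2.2.2.2
  have h2 := hasSum_re_expectation hA hE.2 hρ.1.2.2.2.2
  have h3 : HasSum (fun i => entropyDeriv kB (l i) * (quad σ (b i) - l i))
      ((expectation A σ).re - (expectation A ρ).re) := by
    refine (h1.sub h2).congr_fun fun i => ?_
    rw [quad_basis hb, mul_sub]
  have h4 := (entropy_le_of_hasSum hkB hρ.1.1 hb hE.1 hρ.2.2 hσ.1.1 hσ.2.1 h3).2
  simp only [Set.mem_ofPred_eq]
  linarith

/-- The common domain of the operators. -/
def commonDomain (Oε : H →ₗ.[ℂ] H) (Ov : Fin d → (H →ₗ.[ℂ] H)) (A : H →ₗ.[ℂ] H) :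
    Submodule ℂ H :=
  Oε.domain ⊓ (⨅ i, (Ov i).domain) ⊓ A.domain

theorem mem_commonDomain {φ : H} : φ ∈ commonDomain Oε Ov A ↔
    φ ∈ Oε.domain ∧ (∀ i, φ ∈ (Ov i).domain) ∧ φ ∈ A.domain := by
  simp [commonDomain, and_assoc]

theorem rankOne_mem_perturbations {φ : H} (hφ : φ ∈ commonDomain Oε Ov A) (h1 : ‖φ‖ = 1) :
    InnerProductSpace.rankOne ℂ φ φ ∈ perturbations Oε Ov A := by
  obtain ⟨g1, g2, g3⟩ := mem_commonDomain.1 hφ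
  refine ⟨⟨InnerProductSpace.isPositive_rankOne_self φ, ⟨_, hasTrace_rankOne φ φ⟩,
    (hasExpectation_rankOne ⟨φ, g1⟩).1, fun i => (hasExpectation_rankOne ⟨φ, g2 i⟩).1,
    (hasExpectation_rankOne ⟨φ, g3⟩).1⟩, ?_⟩
  rw [(hasTrace_rankOne φ φ).trace_eq, inner_self_eq_norm_sq_to_K, h1]
  simp

theorem exists_unit_inner_ne_zero {K : Submodule ℂ H} (hK : Dense (K : Set H)) {x : H}
    (hx : x ≠ 0) : ∃ φ ∈ K, ‖φ‖ = 1 ∧ ⟪x, φ⟫_ℂ ≠ 0 := by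
  by_contra! h
  refine hx (hK.eq_zero_of_inner_left (𝕜 := ℂ) fun φ hφ => ?_)
  by_cases h0 : φ = 0
  · simp [h0]
  · have h1 := h (((‖φ‖⁻¹ : ℝ) : ℂ) • φ) (K.smul_mem _ hφ) (by
      rw [norm_smul]; simp [h0])
    rw [inner_smul_right] at h1
    simpa [h0] using h1

theorem isEntropyEigenbasis_of_isFirstOrderOptimal (hkB : 0 < kB) (hA : IsSelfAdjoint A)
    (hK : Dense (commonDomain Oε Ov A : Set H))
    (hρ : ρ ∈ lagrangianDomain kB Oε Ov A) {ι : Type} {b : HilbertBasis ι ℂ H} {l : ι → ℝ}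
    (hb : ∀ i, ρ (b i) = (l i : ℂ) • b i)
    (hF : IsFirstOrderOptimal (fun σ => entropy kB σ - (expectation A σ).re + c)
      (lagrangianDomain kB Oε Ov A) (perturbations Oε Ov A) ρ) :
    IsEntropyEigenbasis kB A b l := by
  classical
  have hq := quad_basis hb
  have hb0 : ∀ i, b i ≠ 0 := fun i => b.orthonormal.ne_zero i
  have hpos : ∀ᶠ t : ℝ in 𝓝[>] 0, (0 : ℝ) < t := eventually_mem_nhdsWithin
  have hl1 : ∀ i, l i < 1 := fun i => by
    obtain ⟨φ, hφK, hφ1, hφ⟩ := exists_unit_inner_ne_zero hK (hb0 i)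
    obtain ⟨t, ht, ht0⟩ := ((hF _ (rankOne_mem_perturbations hφK hφ1)).1.and hpos).exists
    have h1 := quad_le_of_isPositive_one_sub ht.2.1 (b i)
    rw [quad_add, quad_smul, quad_rankOne, hq, b.orthonormal.1 i] at h1
    have h2 : 0 < t * ‖⟪b i, φ⟫_ℂ‖ ^ 2 := by positivity
    linarith
  obtain ⟨r, hr0, hr1, hlr, hρr⟩ := exists_quad_le hρ.1.1 hρ.1.2.1 hb hl1
  have hl0 : ∀ i, 0 < l i := fun i => by
    by_contra hi
    have hi0 : l i = 0 := le_antisymm (not_lt.1 hi) (by rw [← hq]; exact quad_nonneg hρ.1.1 _)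
    obtain ⟨φ, hφK, hφ1, hφ⟩ := exists_unit_inner_ne_zero hK (hb0 i)
    have hδ := rankOne_mem_perturbations hφK hφ1
    set δ := InnerProductSpace.rankOne ℂ φ φ with hδ_def
    obtain ⟨hD, hd⟩ := hF δ hδ
    rw [hasDerivWithinAt_lagrangian_iff hρ.1.2.2.2.2 hδ.1.2.2.2.2, zero_add,
      ← hasDerivWithinAt_Ioi_iff_Ici, hasDerivWithinAt_iff_tendsto_slope' (by simp)] at hd
    set α := (expectation A δ).re
    obtain ⟨r', hr', hr'1⟩ := exists_between hr1
    have hσr := eventually_quad_add_le δ hr' hρr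
    have hqs := hδ.1.2.1.hasSum_quad b
    set τ := (trace δ).re
    have hqi : 0 < quad δ (b i) := by rw [hδ_def, quad_rankOne]; positivity
    -- a cutoff at which the truncated derivative is too large
    set m := entropyDeriv kB r' with hm_def
    set z := max (m + 1) (m + (α - m * τ + 1) / quad δ (b i)) with hz
    set ε := 1 / (Real.exp (z / kB) + 1) with hε_def
    have hε := one_div_exp_add_one_mem (z / kB)
    have hεz : entropyDeriv kB ε = z := entropyDeriv_one_div hkB z
    have hεr : ε < r' := by
      by_contra hle
      have := entropyDeriv_le hkB (hr0.trans hr') (not_lt.1 hle) hε.2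
      have h2 := le_max_left (m + 1) (m + (α - m * τ + 1) / quad δ (b i))
      linarith
    have hmx : max ε r' < 1 := by rw [max_eq_right hεr.le]; exact hr'1
    have hg := continuous_truncatedDeriv kB hε.1 hmx
    have hgm : ∀ x, m ≤ truncatedDeriv kB r' ε x := fun x =>
      entropyDeriv_le hkB (lt_max_of_lt_left hε.1) (max_le hεr.le (min_le_right _ _)) hr'1
    have hg0 : truncatedDeriv kB r' ε (l i) = z := by
      rw [hi0, truncatedDeriv, min_eq_left (hr0.trans hr').le, max_eq_left hε.1.le, hεz]
    have hgz : ∀ x, truncatedDeriv kB r' ε x ≤ z := fun x => by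
      rw [← hεz]
      exact entropyDeriv_le hkB hε.1 (le_max_left _ _)
        ((max_le_max le_rfl (min_le_right _ _)).trans_lt hmx)
    have hsum : Summable fun j => truncatedDeriv kB r' ε (l j) * quad δ (b j) := by
      refine Summable.of_norm_bounded (hqs.summable.mul_left (|m| + |z|)) fun j => ?_
      rw [norm_mul, Real.norm_eq_abs, Real.norm_eq_abs, abs_of_nonneg (quad_nonneg hδ.1.1 (b j))]
      refine mul_le_mul_of_nonneg_right (abs_le.2 ⟨?_, ?_⟩) (quad_nonneg hδ.1.1 (b j))
      · linarith [hgm (l j), neg_abs_le m, abs_nonneg z]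
      · linarith [hgz (l j), le_abs_self z, abs_nonneg m]
    have h1 : ∑' j, truncatedDeriv kB r' ε (l j) * quad δ (b j) ≤ α := by
      refine le_of_forall_lt fun a ha => ?_
      obtain ⟨a', haa, ha'⟩ := exists_between ha
      refine haa.trans_le (ge_of_tendsto hd ?_)
      filter_upwards [eventually_entropy_add_mul_le hkB hr'1 hρ.1.1 hρ.1.2.1
        (fun x => (hρr x).trans (by gcongr)) hρ.2.2 hδ.1.1 hδ.1.2.1 hσr
        (hD.mono fun t ht => ht.2.2) hg (fun x hx => truncatedDeriv_le hkB hx hmx) hb ha', hpos]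
        with t ht ht0
      rw [slope_def_field]
      simp only [Complex.ofReal_zero, zero_smul, add_zero, sub_zero]
      rw [le_div_iff₀ ht0]
      linarith
    have h2 := le_hasSum (hsum.hasSum.sub (hqs.mul_left m)) i fun j _ => by
      rw [← sub_mul]
      exact mul_nonneg (sub_nonneg.2 (hgm _)) (quad_nonneg hδ.1.1 (b j))
    simp only [hg0] at h2
    have h3 : (α - m * τ + 1) / quad δ (b i) ≤ z - m := by
      linarith [le_max_right (m + 1) (m + (α - m * τ + 1) / quad δ (b i))]
    rw [div_le_iff₀ hqi] at h3
    nlinarith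
  have hl : ∀ i, l i ∈ Set.Ioo (0 : ℝ) 1 := fun i => ⟨hl0 i, hl1 i⟩
  have hbK : ∀ i, b i ∈ commonDomain Oε Ov A := fun i => by
    have e : b i = ρ (((l i)⁻¹ : ℂ) • b i) := by
      have : (l i : ℂ) ≠ 0 := by exact_mod_cast (hl0 i).ne'
      rw [map_smul, hb, smul_smul, inv_mul_cancel₀ this, one_smul]
    rw [e]
    have hdom : ∀ {B : H →ₗ.[ℂ] H}, HasExpectation B ρ → ∀ u, ρ u ∈ B.domain :=
      fun ⟨T, hT, _⟩ u => (hT u).1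
    exact mem_commonDomain.2 ⟨hdom hρ.1.2.2.1 _, fun j => hdom (hρ.1.2.2.2.1 j) _,
      hdom hρ.1.2.2.2.2 _⟩
  have hbA : ∀ i, b i ∈ A.domain := fun i => (mem_commonDomain.1 (hbK i)).2.2
  have key : ∀ φ : A.domain, (φ : H) ∈ commonDomain Oε Ov A → ‖(φ : H)‖ = 1 → ∀ β : ℝ,
      HasSum (fun i => entropyDeriv kB (l i) * ‖⟪b i, φ⟫_ℂ‖ ^ 2) β →
      (⟪(φ : H), A φ⟫_ℂ).re = β := by
    intro φ hφ hφ1 β hβ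
    have hδ := rankOne_mem_perturbations hφ hφ1
    have hd := (hF _ hδ).2
    rw [hasDerivWithinAt_lagrangian_iff hρ.1.2.2.2.2 hδ.1.2.2.2.2, zero_add,
      (hasExpectation_rankOne φ).2] at hd
    simp_rw [← quad_rankOne] at hβ
    have hd' := (hasDerivWithinAt_entropy hkB hρ.1.1 hρ.1.2.1 hb hl hρ.2.2 hδ.1.1
      hδ.1.2.1 hβ).2
    exact (uniqueDiffWithinAt_Ici 0).eq_deriv _ hd hd'
  have hdiag : ∀ i, (⟪b i, A ⟨b i, hbA i⟩⟫_ℂ).re = entropyDeriv kB (l i) := fun i => by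
    refine key ⟨b i, hbA i⟩ (hbK i) (b.orthonormal.1 i) _ ?_
    convert hasSum_ite_eq i (entropyDeriv kB (l i)) using 2 with j
    rw [orthonormal_iff_ite.1 b.orthonormal]
    split_ifs with h <;> simp [h]
  have hreal : ∀ x : A.domain, (⟪(x : H), A x⟫_ℂ).im = 0 := fun x => by
    have h := inner_map_left hA x x
    rw [← inner_conj_symm] at h
    exact Complex.conj_eq_iff_im.1 h
  have hoff : ∀ i j, i ≠ j → ⟪b i, A ⟨b j, hbA j⟩⟫_ℂ = 0 := by
    intro i j hij
    have hre : ∀ u : ℂ, ‖u‖ = 1 → (u * ⟪b i, A ⟨b j, hbA j⟩⟫_ℂ).re = 0 := by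
      intro u hu
      let x : A.domain := ⟨b i, hbA i⟩
      let y : A.domain := ⟨b j, hbA j⟩
      let φ : A.domain := ((3 / 5 : ℝ) : ℂ) • x + (((4 / 5 : ℝ) : ℂ) * u) • y
      have hcoord : ∀ k, ⟪b k, (φ : H)⟫_ℂ =
          ((3 / 5 : ℝ) : ℂ) * (if k = i then 1 else 0) +
            ((4 / 5 : ℝ) : ℂ) * u * (if k = j then 1 else 0) := fun k => by
        have : (φ : H) = ((3 / 5 : ℝ) : ℂ) • b i + (((4 / 5 : ℝ) : ℂ) * u) • b j := rfl
        rw [this, inner_add_right, inner_smul_right, inner_smul_right,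
          orthonormal_iff_ite.1 b.orthonormal, orthonormal_iff_ite.1 b.orthonormal]
      have hsq : ∀ k, ‖⟪b k, (φ : H)⟫_ℂ‖ ^ 2 =
          (if k = i then 9 / 25 else 0) + (if k = j then 16 / 25 else 0) := fun k => by
        rw [hcoord]
        by_cases h1 : k = i
        · have h2 : k ≠ j := fun h => hij (h1.symm.trans h)
          simp [h1, hij]; norm_num
        · by_cases h2 : k = j
          · simp [h2, hij.symm, hu]; norm_num
          · simp [h1, h2]
      have hφ1 : ‖(φ : H)‖ = 1 := by
        have h := hasSum_norm_inner_sq b (φ : H)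
        simp_rw [hsq] at h
        have h2 := h.unique ((hasSum_ite_eq i (9 / 25 : ℝ)).add (hasSum_ite_eq j (16 / 25 : ℝ)))
        norm_num at h2
        exact h2.resolve_right (by linarith [norm_nonneg (φ : H)])
      have h := key φ ((commonDomain Oε Ov A).add_mem
        ((commonDomain Oε Ov A).smul_mem _ (hbK i)) ((commonDomain Oε Ov A).smul_mem _ (hbK j)))
        hφ1 (entropyDeriv kB (l i) * (9 / 25) + entropyDeriv kB (l j) * (16 / 25)) (by
          convert (hasSum_ite_eq i (entropyDeriv kB (l i) * (9 / 25))).add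
            (hasSum_ite_eq j (entropyDeriv kB (l j) * (16 / 25))) using 2 with k
          rw [hsq, mul_add]
          congr 1
          · split_ifs with h <;> simp [h]
          · split_ifs with h <;> simp [h])
      have hAφ : A φ = ((3 / 5 : ℝ) : ℂ) • A x + (((4 / 5 : ℝ) : ℂ) * u) • A y := by
        rw [LinearPMap.map_add, LinearPMap.map_smul, LinearPMap.map_smul]
      have hφe : (φ : H) = ((3 / 5 : ℝ) : ℂ) • b i + (((4 / 5 : ℝ) : ℂ) * u) • b j := rfl
      have hyx : ⟪b j, A x⟫_ℂ = (starRingEnd ℂ) ⟪b i, A y⟫_ℂ := by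
        rw [inner_conj_symm]
        exact (inner_map_left hA y x).symm
      have hu2 : u.re * u.re + u.im * u.im = 1 := by
        rw [← Complex.normSq_apply, Complex.normSq_eq_norm_sq, hu]; norm_num
      have hi := hdiag i
      have hj := hdiag j
      have hj' := hreal y
      have hi' := hreal x
      change (⟪b i, A x⟫_ℂ).re = _ at hi
      change (⟪b j, A y⟫_ℂ).re = _ at hj
      change (⟪b i, A x⟫_ℂ).im = _ at hi'
      change (⟪b j, A y⟫_ℂ).im = _ at hj'
      rw [hAφ, hφe] at h
      simp only [inner_add_left, inner_add_right, inner_smul_left, inner_smul_right, hyx] at h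
      generalize ⟪b i, A x⟫_ℂ = X at *
      generalize ⟪b j, A y⟫_ℂ = Y at *
      change (u * ⟪b i, A y⟫_ℂ).re = 0
      generalize ⟪b i, A y⟫_ℂ = p at *
      simp only [map_mul, Complex.conj_ofReal, Complex.add_re, Complex.mul_re, Complex.mul_im,
        Complex.add_im, Complex.ofReal_re, Complex.ofReal_im, Complex.conj_re, Complex.conj_im] at h ⊢
      linear_combination (25 / 24) * h - (9 / 24) * hi - (16 / 24) * (Y.re * hu2 + hj)
    have e1 := hre 1 (by simp)
    have e2 := hre Complex.I (by simp)
    apply Complex.ext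
    · simpa using e1
    · simpa using e2
  refine ⟨hl, fun i => ⟨hbA i, ?_⟩⟩
  refine b.repr.injective (lp.ext (funext fun k => ?_))
  rw [b.repr_apply_apply, b.repr_apply_apply, inner_smul_right,
    orthonormal_iff_ite.1 b.orthonormal]
  split_ifs with h
  · subst h
    rw [mul_one]
    exact Complex.ext (hdiag k) (hreal ⟨b k, hbA k⟩)
  · rw [hoff k i h, mul_zero]

end Optimality

section FunctionalCalculus

variable {H : Type} [NormedAddCommGroup H] [InnerProductSpace ℂ H] [CompleteSpace H]
  {kB : ℝ} {A : H →ₗ.[ℂ] H} {ρ : H →L[ℂ] H}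

theorem toUnbOp_apply (ρ : H →L[ℂ] H) (u : (toUnbOp ρ).domain) : toUnbOp ρ u = ρ u := rfl

section Multiplication

variable {X : Type} [MeasurableSpace X] {μ : Measure X}

theorem coeFn_map_smul (U : H ≃ₗᵢ[ℂ] Lp ℂ 2 μ) (c : ℂ) (u : H) :
    (U (c • u) : X → ℂ) =ᵐ[μ] fun x => c * (U u : X → ℂ) x := by
  rw [map_smul]
  filter_upwards [Lp.coeFn_smul c (U u)] with x hx
  rw [hx]; rfl

theorem coeFn_map_add (U : H ≃ₗᵢ[ℂ] Lp ℂ 2 μ) (u v : H) :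
    (U (u + v) : X → ℂ) =ᵐ[μ] fun x => (U u : X → ℂ) x + (U v : X → ℂ) x := by
  rw [map_add]
  filter_upwards [Lp.coeFn_add (U u) (U v)] with x hx
  rw [hx]; rfl

theorem map_ext {U : H ≃ₗᵢ[ℂ] Lp ℂ 2 μ} {u v : H} (h : (U u : X → ℂ) =ᵐ[μ] (U v : X → ℂ)) :
    u = v :=
  U.injective (Lp.ext h)

/-- The maximal domain of a multiplication operator. -/
def multiplicationDomain (U : H ≃ₗᵢ[ℂ] Lp ℂ 2 μ) (g : X → ℝ) : Submodule ℂ H where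
  carrier := {u | MemLp (fun x => (g x : ℂ) * (U u : X → ℂ) x) 2 μ}
  zero_mem' := by
    refine (MemLp.zero (ε := ℂ)).ae_eq ?_
    rw [map_zero]
    filter_upwards [Lp.coeFn_zero ℂ 2 μ] with x hx
    rw [hx]; simp
  add_mem' := fun {u v} hu hv => by
    refine (MemLp.add hu hv).ae_eq ?_
    filter_upwards [coeFn_map_add U u v] with x hx
    simp only [Pi.add_apply, hx]
    ring
  smul_mem' := fun c u hu => by
    refine (MemLp.const_smul hu c).ae_eq ?_
    filter_upwards [coeFn_map_smul U c u] with x hx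
    simp only [Pi.smul_apply, smul_eq_mul, hx]
    ring

/-- The product with a real function, transported by a unitary map. -/
def multiplicationFun (U : H ≃ₗᵢ[ℂ] Lp ℂ 2 μ) (g : X → ℝ) (u : multiplicationDomain U g) : H :=
  U.symm (MemLp.toLp _ u.2)

theorem coeFn_multiplicationFun (U : H ≃ₗᵢ[ℂ] Lp ℂ 2 μ) (g : X → ℝ)
    (u : multiplicationDomain U g) :
    (U (multiplicationFun U g u) : X → ℂ) =ᵐ[μ] fun x => (g x : ℂ) * (U (u : H) : X → ℂ) x := by
  rw [multiplicationFun, U.apply_symm_apply]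
  exact MemLp.coeFn_toLp _

/-- The maximal multiplication operator by a real function, transported by a unitary map. -/
def multiplicationOp (U : H ≃ₗᵢ[ℂ] Lp ℂ 2 μ) (g : X → ℝ) : H →ₗ.[ℂ] H where
  domain := multiplicationDomain U g
  toFun :=
    { toFun := multiplicationFun U g
      map_add' := fun u v => by
        refine map_ext (U := U) ?_
        filter_upwards [coeFn_multiplicationFun U g (u + v), coeFn_multiplicationFun U g u,
          coeFn_multiplicationFun U g v, coeFn_map_add U (u : H) v,
          coeFn_map_add U (multiplicationFun U g u) (multiplicationFun U g v)]
          with x h1 h2 h3 h4 h5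
        rw [h1, h5, h2, h3, Submodule.coe_add, h4]
        ring
      map_smul' := fun c u => by
        refine map_ext (U := U) ?_
        filter_upwards [coeFn_multiplicationFun U g (c • u), coeFn_multiplicationFun U g u,
          coeFn_map_smul U c (u : H), coeFn_map_smul U c (multiplicationFun U g u)]
          with x h1 h2 h3 h4
        rw [h1, RingHom.id_apply, h4, h2, Submodule.coe_smul, h3]
        ring }

theorem isMultiplicationBy_multiplicationOp (U : H ≃ₗᵢ[ℂ] Lp ℂ 2 μ) (g : X → ℝ) :
    IsMultiplicationBy U g (multiplicationOp U g) :=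
  ⟨fun _ => Iff.rfl, coeFn_multiplicationFun U g⟩

theorem memLp_mul_of_abs_le_one (w : Lp ℂ 2 μ) {g : X → ℝ} (hg : Measurable g)
    (hg1 : ∀ x, |g x| ≤ 1) : MemLp (fun x => (g x : ℂ) * (w : X → ℂ) x) 2 μ := by
  refine (Lp.memLp w).of_le
    ((Complex.measurable_ofReal.comp hg).aestronglyMeasurable.mul (Lp.aestronglyMeasurable w))
    (.of_forall fun x => ?_)
  rw [norm_mul, Complex.norm_real, Real.norm_eq_abs]
  exact mul_le_of_le_one_left (norm_nonneg _) (hg1 x)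

end Multiplication

theorem isFunctionOf_iff_exists_isInverseOfAddOne (hkB : 0 < kB) :
    IsFunctionOf A (sDerivInv kB) (toUnbOp ρ) ↔
      ∃ B : H →ₗ.[ℂ] H, IsFunctionOf A (fun z => Real.exp (z / kB)) B ∧ IsInverseOfAddOne B ρ := by
  have hf : sDerivInv kB = fun z => 1 / (Real.exp (z / kB) + 1) := funext (sDerivInv_eq hkB)
  have hne : ∀ z : ℝ, (Real.exp z : ℂ) + 1 ≠ 0 := fun z => by
    exact_mod_cast (by positivity : Real.exp z + 1 ≠ 0)
  constructor
  · rintro ⟨X, _, μ, U, h, hm, hA, hρ⟩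
    have hB := isMultiplicationBy_multiplicationOp U fun x => Real.exp (h x / kB)
    refine ⟨_, ⟨X, _, μ, U, h, hm, hA, hB⟩, fun u => ?_, fun u => ?_⟩
    · have h1 := hρ.2 ⟨u, trivial⟩
      rw [toUnbOp_apply, hf] at h1
      have h2 : (fun x => (Real.exp (h x / kB) : ℂ) * (U (ρ u) : X → ℂ) x) =ᵐ[μ]
          (U (u - ρ u) : X → ℂ) := by
        rw [map_sub]
        filter_upwards [h1, Lp.coeFn_sub (U u) (U (ρ u))] with x hx hx2
        rw [hx2, Pi.sub_apply, hx]
        have := hne (h x / kB)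
        push_cast at this ⊢
        field_simp
        ring
      have hdom : ρ u ∈ (multiplicationOp U fun x => Real.exp (h x / kB)).domain :=
        (hB.1 _).2 ((Lp.memLp _).ae_eq h2.symm)
      refine ⟨hdom, ?_⟩
      rw [map_ext ((hB.2 ⟨ρ u, hdom⟩).trans h2), sub_add_cancel]
    · refine map_ext (U := U) ?_
      have h1 := hρ.2 ⟨multiplicationOp U (fun x => Real.exp (h x / kB)) u + (u : H), trivial⟩
      rw [toUnbOp_apply, hf] at h1
      filter_upwards [h1, hB.2 u, coeFn_map_add U (multiplicationOp U (fun x =>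
        Real.exp (h x / kB)) u) u] with x hx hx2 hx3
      rw [hx, hx3, hx2]
      have := hne (h x / kB)
      push_cast at this ⊢
      field_simp
  · rintro ⟨B, ⟨X, _, μ, U, h, hm, hA, hB⟩, hi, -⟩
    have hfm : Measurable fun x => 1 / (Real.exp (h x / kB) + 1) := by fun_prop
    refine ⟨X, _, μ, U, h, hm, hA, fun u => ⟨fun _ => ?_, fun _ => trivial⟩, fun u => ?_⟩
    · rw [hf]
      refine memLp_mul_of_abs_le_one (U u) hfm fun x => ?_
      have := one_div_exp_add_one_mem (h x / kB)
      rw [abs_of_pos this.1]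
      exact this.2.le
    · obtain ⟨hdom, e⟩ := hi u
      rw [toUnbOp_apply, hf]
      have h1 := hB.2 ⟨ρ u, hdom⟩
      have h2 := coeFn_map_add U (B ⟨ρ u, hdom⟩) (ρ u)
      rw [e] at h2
      filter_upwards [h1, h2] with x hx1 hx2
      rw [hx2, hx1]
      have := hne (h x / kB)
      push_cast at this ⊢
      field_simp

theorem isEntropyEigenbasis_of_isFunctionOf (hkB : 0 < kB)
    (hf : IsFunctionOf A (sDerivInv kB) (toUnbOp ρ)) {ι : Type} {b : HilbertBasis ι ℂ H}
    {l : ι → ℝ} (hb : ∀ i, ρ (b i) = (l i : ℂ) • b i) : IsEntropyEigenbasis kB A b l := by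
  obtain ⟨X, _, μ, U, h, hm, hA, hρ⟩ := hf
  have hae : ∀ i, ∀ᵐ x ∂μ, (U (b i) : X → ℂ) x ≠ 0 → sDerivInv kB (h x) = l i := fun i => by
    have h1 := hρ.2 ⟨b i, trivial⟩
    rw [toUnbOp_apply, hb] at h1
    filter_upwards [h1, coeFn_map_smul U (l i) (b i)] with x hx1 hx2 hx
    rw [hx2] at hx1
    exact_mod_cast (mul_right_cancel₀ hx hx1).symm
  have hl : ∀ i, l i ∈ Set.Ioo (0 : ℝ) 1 := fun i => by
    have hne : ∃ᵐ x ∂μ, (U (b i) : X → ℂ) x ≠ 0 := by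
      intro h0
      refine b.orthonormal.ne_zero i (map_ext (U := U) ?_)
      rw [map_zero]
      filter_upwards [h0, Lp.coeFn_zero ℂ 2 μ] with x hx hx2
      rw [hx2]
      simpa using hx
    obtain ⟨x, hx, hx2⟩ := (hne.and_eventually (hae i)).exists
    rw [← hx2 hx, sDerivInv_eq hkB]
    exact one_div_exp_add_one_mem _
  refine ⟨hl, fun i => ?_⟩
  have h1 : (fun x => (h x : ℂ) * (U (b i) : X → ℂ) x) =ᵐ[μ]
      (U ((entropyDeriv kB (l i) : ℂ) • b i) : X → ℂ) := by
    filter_upwards [hae i, coeFn_map_smul U (entropyDeriv kB (l i)) (b i)] with x hx hx2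
    rw [hx2]
    by_cases h0 : (U (b i) : X → ℂ) x = 0
    · simp [h0]
    · rw [← hx h0, sDerivInv_eq hkB, entropyDeriv_one_div hkB]
  have hdom : b i ∈ A.domain := (hA.1 _).2 ((Lp.memLp _).ae_eq h1.symm)
  exact ⟨hdom, map_ext ((hA.2 ⟨b i, hdom⟩).trans h1)⟩

theorem inner_map_of_diagonal (hA : IsSelfAdjoint A) {ι : Type} {b : HilbertBasis ι ℂ H}
    {a : ι → ℝ} (hb : ∀ i, ∃ h : b i ∈ A.domain, A ⟨b i, h⟩ = (a i : ℂ) • b i) (u : A.domain)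
    (i : ι) : ⟪b i, A u⟫_ℂ = a i * ⟪b i, (u : H)⟫_ℂ := by
  obtain ⟨h, e⟩ := hb i
  have := inner_map_left hA ⟨b i, h⟩ u
  rw [← this, e, inner_smul_left, Complex.conj_ofReal]

theorem mem_domain_of_diagonal (hA : IsSelfAdjoint A) {ι : Type} {b : HilbertBasis ι ℂ H}
    {a : ι → ℝ} (hb : ∀ i, ∃ h : b i ∈ A.domain, A ⟨b i, h⟩ = (a i : ℂ) • b i) {u w : H}
    (hw : ∀ i, ⟪b i, w⟫_ℂ = a i * ⟪b i, u⟫_ℂ) : u ∈ A.domain := by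
  rw [← (LinearPMap.isSelfAdjoint_def.1 hA : LinearPMap.adjoint A = A)]
  refine LinearPMap.mem_adjoint_domain_of_exists _ ⟨w, fun x => ?_⟩
  have h1 := b.hasSum_inner_mul_inner w x
  have h2 := b.hasSum_inner_mul_inner u (A x)
  refine h1.unique (h2.congr_fun fun i => ?_)
  rw [inner_map_of_diagonal hA hb, ← inner_conj_symm, hw, map_mul, Complex.conj_ofReal,
    inner_conj_symm]
  ring

theorem exists_isometryEquiv_Lp_count {ι : Type} [MeasurableSpace ι] [MeasurableSingletonClass ι]
    (b : HilbertBasis ι ℂ H) :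
    ∃ U : H ≃ₗᵢ[ℂ] Lp ℂ 2 (Measure.count : Measure ι),
      ∀ u i, (U u : ι → ℂ) i = ⟪b i, u⟫_ℂ := by
  classical
  have hμ : ∀ i : ι, (Measure.count : Measure ι) {i} ≠ ⊤ := fun i => by simp
  let v : ι → Lp ℂ 2 (Measure.count : Measure ι) := fun i =>
    indicatorConstLp 2 (measurableSet_singleton i) (hμ i) (1 : ℂ)
  have hv : ∀ i (f : Lp ℂ 2 (Measure.count : Measure ι)), ⟪v i, f⟫_ℂ = (f : ι → ℂ) i :=
    fun i f => by
      rw [L2.inner_indicatorConstLp_one]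
      simp
  have hon : Orthonormal ℂ v := by
    rw [orthonormal_iff_ite]
    intro i j
    rw [L2.inner_indicatorConstLp_one_indicatorConstLp_one _ _ (hμ i) (hμ j)]
    by_cases h : i = j
    · simp [h, measureReal_def]
    · simp [h]
  have hbot : (Submodule.span ℂ (Set.range v))ᗮ = ⊥ := by
    rw [eq_bot_iff]
    intro f hf
    rw [Submodule.mem_orthogonal] at hf
    have : ∀ i, (f : ι → ℂ) i = 0 := fun i => by
      rw [← hv]; exact hf _ (Submodule.subset_span ⟨i, rfl⟩)
    refine Lp.ext ?_
    filter_upwards [Lp.coeFn_zero ℂ 2 (Measure.count : Measure ι)] with i hi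
    rw [hi, this]; rfl
  let b' := HilbertBasis.mkOfOrthogonalEqBot hon hbot
  refine ⟨b.repr.trans b'.repr.symm, fun u i => ?_⟩
  rw [← hv]
  have e : v i = b' i := by rw [HilbertBasis.coe_mkOfOrthogonalEqBot]
  rw [e, ← b'.repr_apply_apply, ← b.repr_apply_apply]
  simp

theorem isMultiplicationBy_of_diagonal {ι : Type} [MeasurableSpace ι] [MeasurableSingletonClass ι]
    {b : HilbertBasis ι ℂ H} {U : H ≃ₗᵢ[ℂ] Lp ℂ 2 (Measure.count : Measure ι)}
    (hU : ∀ u i, (U u : ι → ℂ) i = ⟪b i, u⟫_ℂ) (hA : IsSelfAdjoint A) {a : ι → ℝ}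
    (hb : ∀ i, ∃ h : b i ∈ A.domain, A ⟨b i, h⟩ = (a i : ℂ) • b i) :
    IsMultiplicationBy U a A := by
  have h1 : ∀ u : A.domain, (U (A u) : ι → ℂ) = fun i => (a i : ℂ) * (U (u : H) : ι → ℂ) i :=
    fun u => funext fun i => by rw [hU, hU, inner_map_of_diagonal hA hb]
  refine ⟨fun u => ⟨fun hu => ?_, fun hu => ?_⟩, fun u => by rw [h1 u]⟩
  · rw [← h1 ⟨u, hu⟩]
    exact Lp.memLp _
  · refine mem_domain_of_diagonal hA hb (w := U.symm hu.toLp) fun i => ?_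
    rw [← hU, U.apply_symm_apply, ← hU]
    have h2 := hu.coeFn_toLp
    exact Measure.ae_count_iff.1 h2 i

theorem isSelfAdjoint_toUnbOp (hρ : IsSelfAdjoint ρ) : IsSelfAdjoint (toUnbOp ρ) := by
  have h := ContinuousLinearMap.toPMap_adjoint_eq_adjoint_toPMap_of_dense (A := ρ) (p := ⊤)
    (by simp)
  rw [ContinuousLinearMap.isSelfAdjoint_iff'.1 hρ] at h
  exact LinearPMap.isSelfAdjoint_def.2 h

theorem isFunctionOf_of_isEntropyEigenbasis (hkB : 0 < kB) (hA : IsSelfAdjoint A)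
    (hρ : IsSelfAdjoint ρ) {ι : Type} {b : HilbertBasis ι ℂ H}
    {l : ι → ℝ} (hb : ∀ i, ρ (b i) = (l i : ℂ) • b i) (hE : IsEntropyEigenbasis kB A b l) :
    IsFunctionOf A (sDerivInv kB) (toUnbOp ρ) := by
  let _ : MeasurableSpace ι := ⊤
  obtain ⟨U, hU⟩ := exists_isometryEquiv_Lp_count b
  refine ⟨ι, ⊤, Measure.count, U, fun i => entropyDeriv kB (l i), measurable_from_top,
    isMultiplicationBy_of_diagonal hU hA hE.2, ?_⟩
  refine isMultiplicationBy_of_diagonal hU (isSelfAdjoint_toUnbOp hρ) fun i => ⟨trivial, ?_⟩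
  rw [sDerivInv_eq hkB, one_div_entropyDeriv hkB (hE.1 i), ← hb]
  rfl

theorem IsWeylQuantization.mem_domain {d : ℕ} {ħ : ℝ} {a : E d → E d → ℝ}
    {T : L2 d →ₗ.[ℂ] L2 d} (hT : IsWeylQuantization ħ a T) {u : L2 d} {φ : E d → ℂ}
    (hu : (u : E d → ℂ) =ᵐ[volume] φ) (hφ : HasCompactSupport φ) (hφ' : ContDiff ℝ ∞ φ) :
    u ∈ T.domain :=
  (hT.2 φ hφ' hφ u hu).1

end FunctionalCalculus

end QMEP

end

open QMEP

theorem lemma2 (d : ℕ) (ħ kB : ℝ) (hħ : 0 < ħ) (hkB : 0 < kB)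
    -- the energy band and the velocity
    (ε : QMEP.E d → ℝ) (v : QMEP.E d → QMEP.E d)
    (hv : ∀ᵐ p : QMEP.E d, HasGradientAt ε (v p) p)
    -- the Lagrange multipliers
    (η₀ η₁ : QMEP.E d → ℝ) (η₂ : QMEP.E d → QMEP.E d)
    (hη₀ : ContDiff ℝ ∞ η₀) (hη₁ : ContDiff ℝ ∞ η₁) (hη₂ : ContDiff ℝ ∞ η₂)
    -- the prescribed moments
    (n W : QMEP.E d → ℝ) (J : QMEP.E d → QMEP.E d)
    (hM : Integrable (fun x : QMEP.E d => η₀ x * n x + η₁ x * W x + ⟪η₂ x, J x⟫_ℝ))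
    -- the operators `Op_ħ(ε)`, `Op_ħ(v)`, `Op_ħ(η · ψ)`
    (Oε : QMEP.L2 d →ₗ.[ℂ] QMEP.L2 d) (hOε : QMEP.IsWeylQuantization ħ (fun _ p => ε p) Oε)
    (Ov : Fin d → (QMEP.L2 d →ₗ.[ℂ] QMEP.L2 d))
    (hOv : ∀ i, QMEP.IsWeylQuantization ħ (fun _ p => v p i) (Ov i))
    (A : QMEP.L2 d →ₗ.[ℂ] QMEP.L2 d)
    (hA : QMEP.IsWeylQuantization ħ (QMEP.multiplierSymbol η₀ η₁ η₂ ε v) A) :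
    -- `s'` is invertible, and its inverse is explicit
    Set.BijOn (deriv (QMEP.s kB)) (Set.Ioo 0 1) Set.univ ∧
    (∀ z : ℝ, QMEP.sDerivInv kB z = 1 / (Real.exp (z / kB) + 1)) ∧
    ∀ ρ ∈ QMEP.lagrangianDomain kB Oε Ov A,
      -- first order optimality is equivalent to `ρ = (s')⁻¹(Op_ħ(η · ψ))`
      (QMEP.IsFirstOrderOptimal (QMEP.lagrangian kB A η₀ η₁ η₂ n W J)
          (QMEP.lagrangianDomain kB Oε Ov A) (QMEP.perturbations Oε Ov A) ρ ↔
        QMEP.IsFunctionOf A (QMEP.sDerivInv kB) (QMEP.toUnbOp ρ)) ∧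
      -- that is, to `ρ = (exp(Op_ħ(η · ψ) / k_B) + 1)⁻¹`
      (QMEP.IsFunctionOf A (QMEP.sDerivInv kB) (QMEP.toUnbOp ρ) ↔
        ∃ B : QMEP.L2 d →ₗ.[ℂ] QMEP.L2 d, QMEP.IsFunctionOf A (fun z => Real.exp (z / kB)) B ∧
          QMEP.IsInverseOfAddOne B ρ) ∧
      -- such an operator is a point of maximum of the Lagrangian
      (QMEP.IsFunctionOf A (QMEP.sDerivInv kB) (QMEP.toUnbOp ρ) →
        IsMaxOn (QMEP.lagrangian kB A η₀ η₁ η₂ n W J)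
          (QMEP.lagrangianDomain kB Oε Ov A) ρ) := by
  refine ⟨bijOn_deriv_s hkB, sDerivInv_eq hkB, fun ρ hρ => ?_⟩
  obtain ⟨ι, b, l, hb⟩ := exists_eigenbasis hρ.1.1 hρ.1.2.1
  have hK : Dense (commonDomain Oε Ov A : Set (L2 d)) := by
    refine (Lp.dense_hasCompactSupport_contDiff (F := ℂ) (μ := (volume : Measure (E d)))
      (p := 2) (by simp)).mono ?_
    rintro u ⟨φ, hu, hc, hs⟩
    exact mem_commonDomain.2 ⟨hOε.mem_domain hu hc hs, fun i => (hOv i).mem_domain hu hc hs,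
      hA.mem_domain hu hc hs⟩
  refine ⟨⟨fun h => ?_, fun h => ?_⟩, isFunctionOf_iff_exists_isInverseOfAddOne hkB, fun h => ?_⟩
  · exact isFunctionOf_of_isEntropyEigenbasis hkB hA.1 hρ.1.1.isSelfAdjoint hb
      (isEntropyEigenbasis_of_isFirstOrderOptimal hkB hA.1 hK hρ hb h)
  · exact isFirstOrderOptimal_of_isEntropyEigenbasis hkB hA.1 hρ hb
      (isEntropyEigenbasis_of_isFunctionOf hkB h hb)
  · exact isMaxOn_of_isEntropyEigenbasis hkB hA.1 hρ hb
      (isEntropyEigenbasis_of_isFunctionOf hkB h hb)
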